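/- Conventions. A rewriting system (monoid presentation) $\langle A\mid R\rangle$ consists of a finite alphabet $A$ and a set $R\subseteq A^*\times A^*$; it is finite if $R$ is finite, and complete if its one-step reduction relation admits no infinite reduction sequence and is confluent. It presents every monoid isomorphic to the quotient of the free monoid $A^*$ by the congruence generated by $R$. The derivation graph $\Gamma$ of $\langle A\mid R\rangle$ has vertex set $A^*$ and an edge $e=(w_1,r,\epsilon,w_2)$ from $\iota e=w_1r_{\epsilon}w_2$ to $\tau e=w_1r_{-\epsilon}w_2$ for all $w_1,w_2\in A^*$, $r=(r_{+1},r_{-1})\in R$, $\epsilon=\pm1$, with inverse edge $(w_1,r,-\epsilon,w_2)$; $A^*$ acts on edges and paths from the left and from the right. A homotopy relation is an equivalence relation $\sim$ between parallel paths (paths with the same endpoints) of $\Gamma$ such that: $(e\cdot\iota f)\circ(\tau e\cdot f)\sim(\iota e\cdot f)\circ(e\cdot\tau f)$ for all edges $e,f$; $p\sim q$ implies $x\cdot p\cdot y\sim x\cdot q\cdot y$ for all $x,y\in A^*$; $p\sim q$ implies $r\circ p\circ s\sim r\circ q\circ s$ whenever the compositions are defined; and $p\circ p^{-1}\sim 1_{\iota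 p}$ for all paths $p$. The presentation has finite derivation type if there is a finite set $C$ of pairs of parallel paths such that the smallest homotopy relation containing $C$ consists of all pairs of parallel paths. A monoid has finite derivation type (FDT) if some finite presentation of it has finite derivation type. Let $T$ be a subsemigroup of a semigroup $S$, let $S^1$ be $S$ with a new identity $1$ adjoined, and $T^1=T\cup\{1\}$. For $u,v\in S$ write $u\,\mathcal H^T v$ if $uT^1=vT^1$ and $T^1u=T^1v$. Each $\mathcal H^T$-class lies in $T$ or in $S\setminus T$; the Green index of $T$ in $S$ is one more than the number of $\mathcal H^T$-classes in $S\setminus T$. For an $\mathcal H^T$-class $H$ let $\mathrm{Stab}(H)=\{t\in T^1: Ht=H\}$ and let $\gamma(H)$ be the congruence on $\mathrm{Stab}(H)$ given by $(x,y)\in\gamma(H)$ if and only if $hx=hy$ for all $h\in H$. The group $\mathrm{Stab}(H)/\gamma(H)$ is the $T$-relative Schützenberger group of $H$. Theorem. Let $M$ be the monoid defined by the presentation with generators $a,a^{-1},b,b^{-1},h$ and relations $$aa^{-1}=a^{-1}a=bb^{-1}=b^{-1}b=1,\qquad xh=hx,\quad hxy=hyx\quad(x,y\in\{a,a^{-1},b,b^{-1}\}),$$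 $$h^2a=h^2a^{-1}=h^2b=h^2b^{-1}=h^3=h^2.$$ Let $S=M$ and let $T$ be the group of units of $M$. Then $T$ is a subsemigroup of finite Green index in $S$, and: (i) $T$ and the $T$-relative Schützenberger groups of all $\mathcal H^T$-classes in $S\setminus T$ admit presentations by finite complete rewriting systems and have finite derivation type; (ii) $S$ does not have finite derivation type, and does not admit a presentation by a finite complete rewriting system. -/

import Mathlib

namespace SemigroupFDT

open scoped Pointwise

/-! Monoid presentations and complete rewriting systems. -/

/-- A rewriting system over the alphabet `A`: a set of rules `(r₊₁, r₋₁)` of words of `A*`. -/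
abbrev RewritingSystem (A : Type*) := Set (FreeMonoid A × FreeMonoid A)

/-- The monoid `A* / ↔*_R` defined by the presentation `⟨A | R⟩`, where `↔*_R` is the congruence
generated by `R`. -/
abbrev MonoidOf {A : Type*} (R : RewritingSystem A) : Type _ :=
  PresentedMonoid fun u v => (u, v) ∈ R

/-- One-step reduction `u →_R v`. -/
def Step {A : Type*} (R : RewritingSystem A) (u v : FreeMonoid A) : Prop :=
  ∃ r ∈ R, ∃ w₁ w₂ : FreeMonoid A, u = w₁ * r.1 * w₂ ∧ v = w₁ * r.2 * w₂

/-- There is no infinite reduction sequence `u₀ →_R u₁ →_R u₂ →_R ⋯`. -/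
def IsNoetherian {A : Type*} (R : RewritingSystem A) : Prop :=
  ¬ ∃ u : ℕ → FreeMonoid A, ∀ n, Step R (u n) (u (n + 1))

/-- Any two words to which a word reduces have a common descendant. -/
def IsConfluent {A : Type*} (R : RewritingSystem A) : Prop :=
  ∀ w u v : FreeMonoid A,
    Relation.ReflTransGen (Step R) w u → Relation.ReflTransGen (Step R) w v →
      ∃ z, Relation.ReflTransGen (Step R) u z ∧ Relation.ReflTransGen (Step R) v z

/-- A complete (convergent) rewriting system. -/
def IsCompleteSystem {A : Type*} (R : RewritingSystem A) : Prop :=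
  IsNoetherian R ∧ IsConfluent R

/-- `S` is (a monoid that is) presented by a finite complete rewriting system. Only the
multiplication of `S` enters, so that the notion applies to subsemigroups as well. -/
def HasFiniteCompleteRewritingSystem (S : Type*) [Mul S] : Prop :=
  ∃ (A : Type) (_ : Finite A) (R : RewritingSystem A),
    R.Finite ∧ IsCompleteSystem R ∧ Nonempty (S ≃* MonoidOf R)

/-! Derivation graphs and finite derivation type. -/

/-- The vertex set `A*` of the derivation graph of `⟨A | R⟩`. -/
def Vertex {A : Type*} (_R : RewritingSystem A) := FreeMonoid A

instance {A : Type*} (R : RewritingSystem A) : Monoid (Vertex R) :=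
  inferInstanceAs (Monoid (FreeMonoid A))

/-- The side `r_ε` of a rule, where `true` stands for `ε = +1` and `false` for `ε = -1`. -/
def side {A : Type*} {R : RewritingSystem A} (r : R) (ε : Bool) : Vertex R :=
  match ε with
  | true => r.1.1
  | false => r.1.2

/-- The edges `(w₁, r, ε, w₂)` of the derivation graph with initial vertex `u = w₁ r_ε w₂` and
terminal vertex `v = w₁ r_{-ε} w₂`. -/
@[ext]
structure DerivationEdge {A : Type*} (R : RewritingSystem A) (u v : Vertex R) where
  left : Vertex R
  rule : R
  sign : Bool
  right : Vertex R
  source_eq : left * side rule sign * right = u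
  target_eq : left * side rule (!sign) * right = v

/-- The derivation graph; its paths (including the empty paths) are Mathlib's `Quiver.Path`s. -/
instance {A : Type*} (R : RewritingSystem A) : Quiver (Vertex R) where
  Hom u v := DerivationEdge R u v

/-- The inverse edge `(w₁, r, -ε, w₂)`. -/
instance {A : Type*} (R : RewritingSystem A) : Quiver.HasInvolutiveReverse (Vertex R) where
  reverse' := fun {_ _} (e : DerivationEdge R _ _) =>
    (⟨e.left, e.rule, !e.sign, e.right, e.target_eq, by
      rw [Bool.not_not]; exact e.source_eq⟩ : DerivationEdge R _ _)
  inv' := fun {_ _} (e : DerivationEdge R _ _) =>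
    DerivationEdge.ext rfl rfl (Bool.not_not e.sign) rfl

/-- The left action `e ↦ x · e` of `A*` on the derivation graph. -/
def actLeft {A : Type*} {R : RewritingSystem A} (x : Vertex R) : Vertex R ⥤q Vertex R where
  obj u := x * u
  map := fun {_ _} (e : DerivationEdge R _ _) =>
    (⟨x * e.left, e.rule, e.sign, e.right,
      by simpa only [mul_assoc] using congrArg (x * ·) e.source_eq,
      by simpa only [mul_assoc] using congrArg (x * ·) e.target_eq⟩ : DerivationEdge R _ _)

/-- The right action `e ↦ e · y` of `A*` on the derivation graph. -/
def actRight {A : Type*} {R : RewritingSystem A} (y : Vertex R) : Vertex R ⥤q Vertex R where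
  obj u := u * y
  map := fun {_ _} (e : DerivationEdge R _ _) =>
    (⟨e.left, e.rule, e.sign, e.right * y,
      by simpa only [mul_assoc] using congrArg (· * y) e.source_eq,
      by simpa only [mul_assoc] using congrArg (· * y) e.target_eq⟩ : DerivationEdge R _ _)

/-- A relation between parallel paths of the derivation graph. -/
abbrev PathRelation {A : Type*} (R : RewritingSystem A) :=
  ∀ u v : Vertex R, Quiver.Path u v → Quiver.Path u v → Prop

/-- Homotopy relations: equivalence relations, contained in parallelism, with (H1)-(H4). -/
structure IsHomotopyRelation {A : Type*} {R : RewritingSystem A} (rel : PathRelation R) :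
    Prop where
  equivalence : ∀ u v, Equivalence (rel u v)
  /-- `(e · ιf) ∘ (τe · f) ∼ (ιe · f) ∘ (e · τf)` -/
  interchange : ∀ {u v u' v' : Vertex R} (e : u ⟶ v) (f : u' ⟶ v'),
    rel (u * u') (v * v')
      (((actRight u').map e).toPath.comp ((actLeft v).map f).toPath)
      (((actLeft u).map f).toPath.comp ((actRight v').map e).toPath)
  /-- `p ∼ q` implies `x · p · y ∼ x · q · y` -/
  act : ∀ {u v : Vertex R} (x y : Vertex R) (p q : Quiver.Path u v), rel u v p q →
    rel (x * u * y) (x * v * y)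
      ((actRight y).mapPath ((actLeft x).mapPath p))
      ((actRight y).mapPath ((actLeft x).mapPath q))
  /-- `p ∼ q` implies `r ∘ p ∘ s ∼ r ∘ q ∘ s` -/
  comp : ∀ {t u v w : Vertex R} (r : Quiver.Path t u) (p q : Quiver.Path u v)
    (s : Quiver.Path v w), rel u v p q → rel t w ((r.comp p).comp s) ((r.comp q).comp s)
  /-- `p ∘ p⁻¹ ∼ 1` -/
  comp_reverse : ∀ {u v : Vertex R} (p : Quiver.Path u v),
    rel u u (p.comp p.reverse) Quiver.Path.nil

/-- The set `∥` of pairs of parallel paths. -/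
abbrev ParallelPair {A : Type*} (R : RewritingSystem A) :=
  Σ u v : Vertex R, Quiver.Path u v × Quiver.Path u v

/-- The homotopy relation `∼_C` generated by `C`: the intersection of all homotopy relations
containing `C`. -/
def HomotopyGenerated {A : Type*} {R : RewritingSystem A} (C : Set (ParallelPair R)) :
    PathRelation R := fun u v p q =>
  ∀ rel : PathRelation R, IsHomotopyRelation rel →
    (∀ c ∈ C, rel c.1 c.2.1 c.2.2.1 c.2.2.2) → rel u v p q

/-- `C` is a homotopy base if `∼_C` is all of `∥`. -/
def IsHomotopyBase {A : Type*} {R : RewritingSystem A} (C : Set (ParallelPair R)) : Prop :=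
  ∀ (u v : Vertex R) (p q : Quiver.Path u v), HomotopyGenerated C u v p q

/-- The presentation `⟨A | R⟩` has finite derivation type. -/
def PresentationHasFDT {A : Type*} (R : RewritingSystem A) : Prop :=
  ∃ C : Set (ParallelPair R), C.Finite ∧ IsHomotopyBase C

/-- `S` has finite derivation type: some finite monoid presentation of `S` has it. -/
def HasFDT (S : Type*) [Mul S] : Prop :=
  ∃ (A : Type) (_ : Finite A) (R : RewritingSystem A),
    R.Finite ∧ Nonempty (S ≃* MonoidOf R) ∧ PresentationHasFDT R

/-! Relative Green's relations, Green index and relative Schützenberger groups. -/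

section Green

variable {S : Type*} [Semigroup S]

/-- `T¹ = T ∪ {1}` inside `S¹`, the semigroup `S` with a new identity adjoined. -/
def adjoinOne (T : Subsemigroup S) : Submonoid (WithOne S) where
  carrier := insert 1 ((fun t : S => (t : WithOne S)) '' T)
  one_mem' := Set.mem_insert _ _
  mul_mem' := by
    rintro _ _ (rfl | ⟨x, hx, rfl⟩) (rfl | ⟨y, hy, rfl⟩)
    · exact Or.inl (one_mul _)
    · exact Or.inr ⟨y, hy, (one_mul _).symm⟩
    · exact Or.inr ⟨x, hx, (mul_one _).symm⟩
    · exact Or.inr ⟨x * y, T.mul_mem hx hy, WithOne.coe_mul x y⟩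

/-- `u ℛ^T v` if and only if `uT¹ = vT¹`. -/
def RelR (T : Subsemigroup S) (u v : S) : Prop :=
  ({(u : WithOne S)} : Set (WithOne S)) * (adjoinOne T : Set (WithOne S)) =
    {(v : WithOne S)} * (adjoinOne T : Set (WithOne S))

/-- `u ℒ^T v` if and only if `T¹u = T¹v`. -/
def RelL (T : Subsemigroup S) (u v : S) : Prop :=
  (adjoinOne T : Set (WithOne S)) * {(u : WithOne S)} =
    (adjoinOne T : Set (WithOne S)) * {(v : WithOne S)}

/-- The relation `ℋ^T = ℛ^T ∩ ℒ^T`. -/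
def relH (T : Subsemigroup S) : Setoid S where
  r u v := RelR T u v ∧ RelL T u v
  iseqv :=
    { refl := fun _ => ⟨rfl, rfl⟩
      symm := fun h => ⟨h.1.symm, h.2.symm⟩
      trans := fun h k => ⟨h.1.trans k.1, h.2.trans k.2⟩ }

/-- The `ℋ^T`-classes in `S \ T`. -/
def outerHClasses (T : Subsemigroup S) : Set (Set S) :=
  {H | H ∈ (relH T).classes ∧ H ⊆ (T : Set S)ᶜ}

/-- The Green index of `T` in `S`. -/
noncomputable def greenIndex (T : Subsemigroup S) : ℕ∞ := (outerHClasses T).encard + 1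

/-- `Stab(H) = {t ∈ T¹ : Ht = H}`. -/
def stab (T : Subsemigroup S) (H : Set S) : Submonoid (WithOne S) where
  carrier := {t | t ∈ adjoinOne T ∧
    ((fun x : S => (x : WithOne S)) '' H) * {t} = (fun x : S => (x : WithOne S)) '' H}
  one_mem' := ⟨(adjoinOne T).one_mem, by rw [Set.singleton_one, mul_one]⟩
  mul_mem' := by
    rintro s t ⟨hs, hs'⟩ ⟨ht, ht'⟩
    refine ⟨(adjoinOne T).mul_mem hs ht, ?_⟩
    rw [← Set.singleton_mul_singleton, ← mul_assoc, hs', ht']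

/-- The congruence `γ(H)` on `Stab(H)`: `x γ y` if and only if `hx = hy` for all `h ∈ H`. -/
def schutzenbergerCon (T : Subsemigroup S) (H : Set S) : Con (stab T H) where
  r x y := ∀ h ∈ H, (h : WithOne S) * (x : WithOne S) = (h : WithOne S) * (y : WithOne S)
  iseqv :=
    { refl := fun _ _ _ => rfl
      symm := fun k h hh => (k h hh).symm
      trans := fun k l h hh => (k h hh).trans (l h hh) }
  mul' := by
    intro w x y z hwx hyz h hh
    have key : (h : WithOne S) * (x : WithOne S) ∈ (fun s : S => (s : WithOne S)) '' H := by
      have h2 := Set.mul_mem_mul (Set.mem_image_of_mem (fun s : S => (s : WithOne S)) hh)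
        (Set.mem_singleton (x : WithOne S))
      rwa [x.2.2] at h2
    obtain ⟨k, hk, hkx⟩ := key
    have hkx' : (k : WithOne S) = (h : WithOne S) * (x : WithOne S) := hkx
    rw [Submonoid.coe_mul, Submonoid.coe_mul, ← mul_assoc, ← mul_assoc, hwx h hh, ← hkx']
    exact hyz k hk

/-- The `T`-relative Schützenberger group `Γ(H) = Stab(H) / γ(H)` of an `ℋ^T`-class `H`, with its
monoid structure as a quotient (for an `ℋ^T`-class it is a group). -/
abbrev SchutzenbergerGroup (T : Subsemigroup S) (H : Set S) : Type _ :=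
  (schutzenbergerCon T H).Quotient

end Green

/-! The monoid `M`. -/

/-- The letters `a, a⁻¹, b, b⁻¹, h`. -/
inductive Letter : Type
  | a | aInv | b | bInv | h

/-- The word of length one. -/
def Letter.word (x : Letter) : FreeMonoid Letter := FreeMonoid.of x

open Letter in
/-- The defining relations of `M`; `x ≠ h` and `y ≠ h` say `x, y ∈ {a, a⁻¹, b, b⁻¹}`. -/
def relationsM : RewritingSystem Letter :=
  {(a.word * aInv.word, 1), (aInv.word * a.word, 1),
    (b.word * bInv.word, 1), (bInv.word * b.word, 1)} ∪
  {r | ∃ x : Letter, x ≠ h ∧ r = (x.word * h.word, h.word * x.word)} ∪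
  {r | ∃ x y : Letter, x ≠ h ∧ y ≠ h ∧
    r = (h.word * x.word * y.word, h.word * y.word * x.word)} ∪
  {r | ∃ x : Letter, x ≠ h ∧ r = (h.word * h.word * x.word, h.word * h.word)} ∪
  {(h.word * h.word * h.word, h.word * h.word)}

/-- The monoid `M`. -/
abbrev M : Type := MonoidOf relationsM

/-- The group of units of `M`, as a subsemigroup. -/
def unitsM : Subsemigroup M := (IsUnit.submonoid M).toSubsemigroup

end SemigroupFDT

/-! Let `F` be the free group on `a`, `b`. The number of letters `h`, truncated at two, splits `M`
into levels. Level zero is `F`, the group of units. Level one is `hℤ²`, because commutators die next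
to `h`. Level two is the zero `h²`. Outside the units there are thus at most two relative classes,
with Schützenberger groups `ℤ²` and `1`. Each of `F`, `ℤ²`, `1` has an evident finite complete
rewriting system. Finite derivation type then follows from Squier's theorem
(`IsCompleteSystem.presentationHasFDT`): a terminating system has all its homotopies generated by
resolutions of overlaps, and there are finitely many of these.

By the same theorem, the negative half reduces to refuting FDT. This is done for an arbitrary
presentation of `M`, so invariance of FDT under change of presentation is not needed. Lift each
generator to `PathModel`, where a level-one element `x h y` remembers what stands on either side of
`h`. A path from `x h y` to `x' h y'` determines the pair `(x⁻¹x', y y'⁻¹)`, whose entries have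
equal image in `ℤ²`. Represent such pairs by matrices with rows `(1, p, v), (0, t, q), (0, 0, 1)`:
the first entry gives `(t, p)`, the second `(t, q)`, and `t` is `2` to the exponent of `b` in both.
Multiplying labels of rules along a path gives `t, p, q` determined by the endpoints
(`pathLabel_eq`), while the corner `v` depends on the path.

Equality of labels modulo central matrices is a homotopy relation on level-one paths
(`isHomotopyRelation_label`). So a finite homotopy base confines the corner discrepancies of
parallel paths to a finitely generated subgroup `W` of `ℚ`. For `m, n ∈ F'`, emitting `m` on the
left of `h` and `n` on the right can be done in either order, and the two orders differ in the
corner by `p(m) q(n)`. Taking `n = [a, b]` and `m = bⁱ[a, b]b⁻ⁱ` puts `2^{-(i+1)}` in `W` for all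
`i`, which is impossible. -/

namespace SemigroupFDT

open Quiver Relation

/-! ### Squier's theorem: finite complete systems have finite derivation type. -/

section Squier

variable {A : Type*} {R : RewritingSystem A}

/-- The edge `(w₁, r, +1, w₂)`. -/
def posEdge (w₁ : Vertex R) (r : R) (w₂ : Vertex R) :
    (w₁ * side r true * w₂ : Vertex R) ⟶ (w₁ * side r false * w₂ : Vertex R) :=
  (⟨w₁, r, true, w₂, rfl, rfl⟩ : DerivationEdge R _ _)

/-- Paths all of whose edges are positive, i.e. reduction sequences. -/
inductive IsPositive : ∀ {u v : Vertex R}, Path u v → Prop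
  | nil {u : Vertex R} : IsPositive (Path.nil : Path u u)
  | cons {u v w : Vertex R} (e : u ⟶ v) (p : Path v w) :
      DerivationEdge.sign e = true → IsPositive p → IsPositive (e.toPath.comp p)

theorem IsPositive.comp {u v w : Vertex R} {p : Path u v} {q : Path v w} (hp : IsPositive p)
    (hq : IsPositive q) : IsPositive (p.comp q) := by
  induction hp with
  | nil => simpa using hq
  | cons e p he _ ih =>
    rw [Path.comp_assoc]
    exact .cons e _ he (ih hq)

theorem IsPositive.act {u v : Vertex R} {p : Path u v} (hp : IsPositive p) (x y : Vertex R) :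
    IsPositive ((actRight y).mapPath ((actLeft x).mapPath p)) := by
  induction hp with
  | nil => exact .nil
  | cons e p he _ ih =>
    rw [Prefunctor.mapPath_comp, Prefunctor.mapPath_comp]
    exact .cons ((actRight y).map ((actLeft x).map e)) _ he ih

theorem IsPositive.toPath {u v : Vertex R} (e : u ⟶ v) (he : DerivationEdge.sign e = true) :
    IsPositive e.toPath := .cons e .nil he .nil

theorem step_of_edge {u v : Vertex R} (e : u ⟶ v) (he : DerivationEdge.sign e = true) :
    Step R u v := by
  obtain ⟨w₁, r, ε, w₂, rfl, rfl⟩ := e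
  obtain rfl : ε = true := he
  exact ⟨r.1, r.2, w₁, w₂, rfl, rfl⟩

theorem exists_edge_of_step {u v : Vertex R} (h : Step R u v) :
    ∃ e : u ⟶ v, DerivationEdge.sign e = true := by
  obtain ⟨r, hr, w₁, w₂, rfl, rfl⟩ := h
  exact ⟨posEdge w₁ ⟨r, hr⟩ w₂, rfl⟩

theorem exists_isPositive {u v : Vertex R} (h : ReflTransGen (Step R) u v) :
    ∃ p : Path u v, IsPositive p := by
  induction h using ReflTransGen.head_induction_on with
  | refl => exact ⟨.nil, .nil⟩
  | head h _ ih =>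
    obtain ⟨e, he⟩ := exists_edge_of_step h
    obtain ⟨p, hp⟩ := ih
    exact ⟨_, .cons e p he hp⟩

theorem IsPositive.reflTransGen {u v : Vertex R} {p : Path u v} (hp : IsPositive p) :
    ReflTransGen (Step R) u v := by
  induction hp with
  | nil => exact .refl
  | cons e p he _ ih => exact .head (step_of_edge e he) ih

/-- A peak of two edges is completed by positive paths to two homotopic paths. -/
def Resolved (rel : PathRelation R) {w u v : Vertex R} (e : w ⟶ u) (f : w ⟶ v) : Prop :=
  ∃ (z : Vertex R) (p : Path u z) (q : Path v z), IsPositive p ∧ IsPositive q ∧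
    rel w z (e.toPath.comp p) (f.toPath.comp q)

variable {rel : PathRelation R}

theorem Resolved.symm (hrel : IsHomotopyRelation rel) {w u v : Vertex R} {e : w ⟶ u} {f : w ⟶ v}
    (h : Resolved rel e f) : Resolved rel f e := by
  obtain ⟨z, p, q, hp, hq, h⟩ := h
  exact ⟨z, q, p, hq, hp, (hrel.equivalence _ _).symm h⟩

theorem eq_of_edge_eq {w u u' : Vertex R} (e : w ⟶ u) (e' : w ⟶ u')
    (hl : DerivationEdge.left e = DerivationEdge.left e')
    (hr : DerivationEdge.rule e = DerivationEdge.rule e')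
    (hs : DerivationEdge.sign e = DerivationEdge.sign e')
    (ht : DerivationEdge.right e = DerivationEdge.right e') : u = u' := by
  rw [← DerivationEdge.target_eq e, ← DerivationEdge.target_eq e', hl, hr, hs, ht]

/-- The components of an edge determine its endpoints, so edges whose targets are only
propositionally equal can be compared component by component. -/
theorem Resolved.congr {w u v u' v' : Vertex R} {e : w ⟶ u} {f : w ⟶ v}
    (h : Resolved rel e f) (e' : w ⟶ u') (f' : w ⟶ v')
    (hel : DerivationEdge.left e = DerivationEdge.left e')
    (her : DerivationEdge.rule e = DerivationEdge.rule e')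
    (hes : DerivationEdge.sign e = DerivationEdge.sign e')
    (het : DerivationEdge.right e = DerivationEdge.right e')
    (hfl : DerivationEdge.left f = DerivationEdge.left f')
    (hfr : DerivationEdge.rule f = DerivationEdge.rule f')
    (hfs : DerivationEdge.sign f = DerivationEdge.sign f')
    (hft : DerivationEdge.right f = DerivationEdge.right f') : Resolved rel e' f' := by
  obtain rfl := eq_of_edge_eq e e' hel her hes het
  obtain rfl := eq_of_edge_eq f f' hfl hfr hfs hft
  obtain rfl : e = e' := DerivationEdge.ext hel her hes het
  obtain rfl : f = f' := DerivationEdge.ext hfl hfr hfs hft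
  exact h

theorem Resolved.act (hrel : IsHomotopyRelation rel) {w u v : Vertex R} {e : w ⟶ u} {f : w ⟶ v}
    (h : Resolved rel e f) (x y : Vertex R) :
    Resolved rel ((actRight y).map ((actLeft x).map e)) ((actRight y).map ((actLeft x).map f)) := by
  obtain ⟨z, p, q, hp, hq, h⟩ := h
  refine ⟨_, _, _, hp.act x y, hq.act x y, ?_⟩
  have key : ∀ {v : Vertex R} (e : w ⟶ v) (p : Path v z),
      (actRight y).mapPath ((actLeft x).mapPath (e.toPath.comp p)) =
        ((actRight y).map ((actLeft x).map e)).toPath.comp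
          ((actRight y).mapPath ((actLeft x).mapPath p)) := fun e p => by
    rw [Prefunctor.mapPath_comp, Prefunctor.mapPath_comp]; rfl
  rw [← key, ← key]
  exact hrel.act x y _ _ h

theorem Resolved.interchange (hrel : IsHomotopyRelation rel) {u v u' v' : Vertex R} (e : u ⟶ v)
    (f : u' ⟶ v') (he : DerivationEdge.sign e = true) (hf : DerivationEdge.sign f = true) :
    Resolved rel ((actRight u').map e) ((actLeft u).map f) :=
  ⟨v * v', _, _, .toPath _ hf, .toPath _ he, hrel.interchange e f⟩

/-- Two occurrences of factors `l`, `l'` in a word are disjoint, or come from an overlap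
`l t = s l' t'`. -/
theorem append_overlap {α : Type*} {w₁ l w₂ w₁' l' w₂' : List α}
    (h : w₁ ++ l ++ w₂ = w₁' ++ l' ++ w₂') (hlen : w₁.length ≤ w₁'.length) :
    ∃ s, w₁' = w₁ ++ s ∧
      ((∃ s', s = l ++ s' ∧ w₂ = s' ++ l' ++ w₂') ∨
      ∃ t t' y, l ++ t = s ++ l' ++ t' ∧ w₂ = t ++ y ∧ w₂' = t' ++ y ∧
        t.length ≤ l'.length ∧ t'.length ≤ l.length ∧ s.length ≤ l.length) := by
  rw [List.append_assoc, List.append_assoc, List.append_eq_append_iff] at h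
  have key : ∃ s, w₁' = w₁ ++ s ∧ l ++ w₂ = s ++ (l' ++ w₂') := by
    rcases h with ⟨s, rfl, h⟩ | ⟨s, rfl, h⟩
    · exact ⟨s, rfl, h⟩
    · have : s = [] := by
        rw [← List.length_eq_zero_iff]
        simp at hlen
        simpa using hlen
      subst this
      exact ⟨[], by simp, by simpa using h.symm⟩
  clear h
  obtain ⟨s, rfl, h⟩ := key
  refine ⟨s, rfl, ?_⟩
  rw [List.append_eq_append_iff] at h
  rcases h with ⟨s', rfl, rfl⟩ | ⟨l₁, rfl, h⟩
  · exact .inl ⟨s', rfl, by simp⟩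
  · right
    rw [List.append_eq_append_iff] at h
    rcases h with ⟨t, rfl, rfl⟩ | ⟨t, rfl, rfl⟩
    -- Here `l'` lies inside `l`; in the remaining case it sticks out on the right.
    · exact ⟨[], t, w₂, by simp, by simp, rfl, by simp, by simp; omega, by simp⟩
    · exact ⟨t, [], w₂', by simp, rfl, by simp, by simp, by simp, by simp⟩

theorem Vertex.overlap {w₁ l w₂ w₁' l' w₂' : Vertex R}
    (h : w₁ * l * w₂ = w₁' * l' * w₂') (hlen : FreeMonoid.length w₁ ≤ FreeMonoid.length w₁') :
    ∃ s : Vertex R, w₁' = w₁ * s ∧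
      ((∃ s' : Vertex R, s = l * s' ∧ w₂ = s' * l' * w₂') ∨
      ∃ t t' y : Vertex R, l * t = s * l' * t' ∧ w₂ = t * y ∧ w₂' = t' * y ∧
        FreeMonoid.length t ≤ FreeMonoid.length l' ∧ FreeMonoid.length t' ≤ FreeMonoid.length l ∧
        FreeMonoid.length s ≤ FreeMonoid.length l) :=
  append_overlap (α := A) h hlen

/-- The data of an overlap `r t = s r' t'` with `t, s, t'` no longer than the left-hand sides. -/
def criticalData (R : RewritingSystem A) (N : ℕ) :
    Set (R × R × FreeMonoid A × FreeMonoid A × FreeMonoid A) :=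
  {c | c.1.1.1 * c.2.2.1 = c.2.2.2.1 * c.2.1.1.1 * c.2.2.2.2 ∧ c.2.2.1.length ≤ N ∧
    c.2.2.2.1.length ≤ N ∧ c.2.2.2.2.length ≤ N}

theorem finite_criticalData [Finite A] (hR : R.Finite) (N : ℕ) : (criticalData R N).Finite := by
  have := hR.to_subtype
  have hf : {l : FreeMonoid A | l.length ≤ N}.Finite := List.finite_length_le A N
  refine ((Set.finite_univ (α := R)).prod ((Set.finite_univ (α := R)).prod
    (hf.prod (hf.prod hf)))).subset ?_
  rintro ⟨r, r', t, s, t'⟩ ⟨-, h₁, h₂, h₃⟩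
  exact ⟨trivial, trivial, h₁, h₂, h₃⟩

/-- The edge of an overlap `r t = s r' t'` that applies `r`. -/
def leftEdge {r r' : R} {t s t' : Vertex R} (h : side r true * t = s * side r' true * t') :
    (s * side r' true * t' : Vertex R) ⟶ (1 * side r false * t : Vertex R) :=
  (⟨1, r, true, t, by rw [one_mul]; exact h, rfl⟩ : DerivationEdge R _ _)

theorem exists_resolution (hR : IsConfluent R) {w u v : Vertex R} (e : w ⟶ u) (f : w ⟶ v)
    (he : DerivationEdge.sign e = true) (hf : DerivationEdge.sign f = true) :
    ∃ (z : Vertex R) (p : Path u z) (q : Path v z), IsPositive p ∧ IsPositive q := by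
  obtain ⟨z, hu, hv⟩ := hR w u v (.single (step_of_edge e he)) (.single (step_of_edge f hf))
  obtain ⟨p, hp⟩ := exists_isPositive hu
  obtain ⟨q, hq⟩ := exists_isPositive hv
  exact ⟨z, p, q, hp, hq⟩

/-- The fillings are chosen before `rel` is quantified, so a single family of parallel pairs serves
all homotopy relations at once. Its range will be the homotopy base. -/
theorem exists_resolution_family (hR : IsConfluent R) (N : ℕ) :
    ∃ F : criticalData R N → ParallelPair R, ∀ rel : PathRelation R,
      (∀ c ∈ Set.range F, rel c.1 c.2.1 c.2.2.1 c.2.2.2) →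
      ∀ (r r' : R) (t s t' : Vertex R) (h : side r true * t = s * side r' true * t'),
        (r, r', t, s, t') ∈ criticalData R N → Resolved rel (leftEdge h) (posEdge s r' t') := by
  have : ∀ c : criticalData R N, ∃ P : ParallelPair R, ∀ rel : PathRelation R,
      rel P.1 P.2.1 P.2.2.1 P.2.2.2 →
        Resolved rel (leftEdge (r := c.1.1) (r' := c.1.2.1) (t := c.1.2.2.1) (s := c.1.2.2.2.1)
          (t' := c.1.2.2.2.2) c.2.1) (posEdge (R := R) c.1.2.2.2.1 c.1.2.1 c.1.2.2.2.2) := by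
    rintro ⟨⟨r, r', t, s, t'⟩, h, h'⟩
    obtain ⟨z, p, q, hp, hq⟩ := exists_resolution hR
      (leftEdge (r := r) (r' := r') (t := t) (s := s) (t' := t') h) (posEdge s r' t') rfl rfl
    exact ⟨⟨_, z, _, _⟩, fun rel hrel => ⟨z, p, q, hp, hq, hrel⟩⟩
  choose F hF using this
  refine ⟨F, fun rel hrel r r' t s t' h hc => ?_⟩
  exact hF ⟨(r, r', t, s, t'), hc⟩ rel (hrel _ ⟨_, rfl⟩)

/-- Disjoint occurrences of left-hand sides are resolved by the interchange law. Overlapping ones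
are translates, by a word on each side, of an overlap in `criticalData`. -/
theorem resolved_of_le (hrel : IsHomotopyRelation rel) {N : ℕ}
    (hN : ∀ r : R, FreeMonoid.length r.1.1 ≤ N)
    (H : ∀ (r r' : R) (t s t' : Vertex R) (h : side r true * t = s * side r' true * t'),
        (r, r', t, s, t') ∈ criticalData R N → Resolved rel (leftEdge h) (posEdge s r' t'))
    {w u v : Vertex R} (e : w ⟶ u) (f : w ⟶ v)
    (he : DerivationEdge.sign e = true) (hf : DerivationEdge.sign f = true)
    (hlen : FreeMonoid.length (DerivationEdge.left e) ≤
      FreeMonoid.length (DerivationEdge.left f)) : Resolved rel e f := by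
  obtain ⟨w₁, r, ε, w₂, h, rfl⟩ := e
  obtain ⟨w₁', r', ε', w₂', h', rfl⟩ := f
  obtain rfl : ε = true := he
  obtain rfl : ε' = true := hf
  obtain ⟨s, hs, ⟨s', hs', hw⟩ | ⟨t, t', y, ht, hw, hw', h₁, h₂, h₃⟩⟩ :=
    Vertex.overlap (h.trans h'.symm) hlen
  · subst hs hs' hw
    have hw : w = w₁ * side r true * s' * (1 * side r' true * w₂') := by
      rw [← h]; simp only [mul_assoc, one_mul]
    subst hw
    refine (Resolved.interchange hrel (posEdge w₁ r s') (posEdge 1 r' w₂') rfl rfl).congr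
      _ _ rfl rfl rfl ?_ ?_ rfl rfl rfl
    · change s' * (1 * side r' true * w₂') = s' * side r' true * w₂'
      simp only [mul_assoc, one_mul]
    · change w₁ * side r true * s' * 1 = w₁ * (side r true * s')
      simp only [mul_assoc, mul_one]
  · subst hs hw hw'
    have hw : w = w₁ * (s * side r' true * t') * y := by
      rw [← h']; simp only [mul_assoc]
    subst hw
    refine ((H r r' t s t' ht ⟨ht, h₁.trans (hN _), h₃.trans (hN _), h₂.trans (hN _)⟩).act hrel
      w₁ y).congr _ _ ?_ rfl rfl rfl rfl rfl rfl rfl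
    exact mul_one w₁

theorem IsNoetherian.wellFounded (hR : IsNoetherian R) :
    WellFounded fun u v : Vertex R => Step R v u :=
  wellFounded_iff_isEmpty_descending_chain.2 ⟨fun f => hR ⟨f.1, f.2⟩⟩

theorem exists_irreducible (hR : IsNoetherian R) (u : Vertex R) :
    ∃ z : Vertex R, ReflTransGen (Step R) u z ∧ ∀ v, ¬ Step R z v := by
  induction u using hR.wellFounded.induction with
  | _ u ih =>
    by_cases h : ∃ v, Step R u v
    · obtain ⟨v, hv⟩ := h
      obtain ⟨z, hz, hz'⟩ := ih v hv
      exact ⟨z, .head hv hz, hz'⟩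
    · exact ⟨u, .refl, not_exists.1 h⟩

theorem reflTransGen_of_irreducible (hR : IsConfluent R) {w u z : Vertex R}
    (hz : ∀ v, ¬ Step R z v) (hu : ReflTransGen (Step R) w u) (hwz : ReflTransGen (Step R) w z) :
    ReflTransGen (Step R) u z := by
  obtain ⟨y, hy, hzy⟩ := hR w u z hu hwz
  rcases ReflTransGen.cases_head hzy with rfl | ⟨v, hv, -⟩
  · exact hy
  · exact absurd hv (hz v)

theorem IsHomotopyRelation.comp_left (hrel : IsHomotopyRelation rel) {u v w : Vertex R}
    (r : Path u v) {p q : Path v w} (h : rel v w p q) : rel u w (r.comp p) (r.comp q) := by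
  simpa using hrel.comp r p q .nil h

theorem IsHomotopyRelation.comp_right (hrel : IsHomotopyRelation rel) {u v w : Vertex R}
    {p q : Path u v} (s : Path v w) (h : rel u v p q) : rel u w (p.comp s) (q.comp s) := by
  simpa using hrel.comp .nil p q s h

/-- A homotopical Newman lemma, by Noetherian induction on the common source: reductions to a normal
form are unique up to homotopy. -/
theorem rel_of_isPositive (hR : IsCompleteSystem R) (hrel : IsHomotopyRelation rel)
    (hres : ∀ {w u v : Vertex R} (e : w ⟶ u) (f : w ⟶ v), DerivationEdge.sign e = true →
      DerivationEdge.sign f = true → Resolved rel e f) {z : Vertex R}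
    (hz : ∀ v, ¬ Step R z v) {w : Vertex R} {p q : Path w z} (hp : IsPositive p)
    (hq : IsPositive q) : rel w z p q := by
  induction w using hR.1.wellFounded.induction with
  | _ w ih =>
    have hequiv := fun u v => hrel.equivalence u v
    cases hp with
    | nil =>
      cases hq with
      | nil => exact (hequiv _ _).refl _
      | cons e q he hq => exact absurd (step_of_edge e he) (hz _)
    | cons e p he hp =>
      cases hq with
      | nil => exact absurd (step_of_edge e he) (hz _)
      | cons f q hf hq =>
        -- The peak closes at `y`, and `s` continues from `y` to `z`. Induction at the targets of
        -- `e` and `f` compares the given tails with those through `y`.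
        obtain ⟨y, p', q', hp', hq', hpq⟩ := hres e f he hf
        have hyz := reflTransGen_of_irreducible hR.2 hz
          (.head (step_of_edge e he) hp'.reflTransGen) (.head (step_of_edge e he) hp.reflTransGen)
        obtain ⟨s, hs⟩ := exists_isPositive hyz
        have h₁ := ih _ (step_of_edge e he) hp (hp'.comp hs)
        have h₂ := ih _ (step_of_edge f hf) hq (hq'.comp hs)
        refine (hequiv _ _).trans (hrel.comp_left e.toPath h₁) ?_
        refine (hequiv _ _).trans ?_ ((hequiv _ _).symm (hrel.comp_left f.toPath h₂))
        rw [← Path.comp_assoc, ← Path.comp_assoc]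
        exact hrel.comp_right s hpq

theorem reflTransGen_of_path (hR : IsConfluent R) {u v z : Vertex R} (p : Path u v)
    (hz : ∀ v, ¬ Step R z v) (h : ReflTransGen (Step R) u z) : ReflTransGen (Step R) v z := by
  induction p with
  | nil => exact h
  | cons p e ih =>
    rcases hs : DerivationEdge.sign e with _ | _
    · refine .head (step_of_edge (reverse e) ?_) ih
      change (!DerivationEdge.sign e) = true
      rw [hs]; rfl
    · exact reflTransGen_of_irreducible hR hz (.single (step_of_edge e hs)) ih

theorem rel_comp_of_isPositive (hR : IsCompleteSystem R) (hrel : IsHomotopyRelation rel)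
    (hres : ∀ {w u v : Vertex R} (e : w ⟶ u) (f : w ⟶ v), DerivationEdge.sign e = true →
      DerivationEdge.sign f = true → Resolved rel e f) {z : Vertex R}
    (hz : ∀ v, ¬ Step R z v) {u v : Vertex R} (p : Path u v) {α : Path u z} {β : Path v z}
    (hα : IsPositive α) (hβ : IsPositive β) : rel u z (p.comp β) α := by
  induction p with
  | nil =>
    rw [Path.nil_comp]
    exact rel_of_isPositive hR hrel hres hz hβ hα
  | cons p e ih =>
    have hequiv := fun u v => hrel.equivalence u v
    rw [← Path.comp_toPath_eq_cons, Path.comp_assoc]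
    rcases hs : DerivationEdge.sign e with _ | _
    · have hs' : DerivationEdge.sign (reverse e) = true := by
        change (!DerivationEdge.sign e) = true
        rw [hs]; rfl
      -- A negative edge is a reduction read backwards: `β` is homotopic to `reverse e` followed by
      -- `β'`, and `e` then cancels.
      obtain ⟨β', hβ'⟩ := exists_isPositive (reflTransGen_of_path hR.2 p hz
        hα.reflTransGen)
      have h₁ := rel_of_isPositive hR hrel hres hz hβ (.cons _ _ hs' hβ')
      refine (hequiv _ _).trans (hrel.comp_left p (hrel.comp_left e.toPath h₁)) ?_
      refine (hequiv _ _).trans (hrel.comp_left p ?_) (ih hβ')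
      rw [← Path.comp_assoc]
      simpa [Path.reverse_toPath] using hrel.comp_right β' (hrel.comp_reverse e.toPath)
    · exact ih (.cons e β hs hβ)

/-- **Squier's theorem**: finite complete rewriting systems have finite derivation type. -/
theorem IsCompleteSystem.presentationHasFDT [Finite A] (hfin : R.Finite)
    (hR : IsCompleteSystem R) : PresentationHasFDT R := by
  obtain ⟨N, hN⟩ := (hfin.image fun r => r.1.length).bddAbove
  have hN' : ∀ r : R, FreeMonoid.length r.1.1 ≤ N := fun r => hN ⟨r.1, r.2, rfl⟩
  obtain ⟨F, hF⟩ := exists_resolution_family hR.2 N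
  have := (finite_criticalData hfin N).to_subtype
  refine ⟨Set.range F, Set.finite_range F, fun u v p q rel hrel hC => ?_⟩
  have hres : ∀ {w u v : Vertex R} (e : w ⟶ u) (f : w ⟶ v), DerivationEdge.sign e = true →
      DerivationEdge.sign f = true → Resolved rel e f := by
    intro w u v e f he hf
    rcases le_total (FreeMonoid.length (DerivationEdge.left e))
      (FreeMonoid.length (DerivationEdge.left f)) with h | h
    · exact resolved_of_le hrel hN' (hF rel hC) e f he hf h
    · exact (resolved_of_le hrel hN' (hF rel hC) f e hf he h).symm hrel
  obtain ⟨z, huz, hz⟩ := exists_irreducible hR.1 u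
  obtain ⟨α, hα⟩ := exists_isPositive huz
  obtain ⟨β, hβ⟩ := exists_isPositive (reflTransGen_of_path hR.2 p hz huz)
  have hequiv := fun u v => hrel.equivalence u v
  -- The right-hand side does not mention `p`, so any two parallel paths are homotopic.
  have key : ∀ p : Path u v, rel u v p (α.comp β.reverse) := fun p => by
    have h := hrel.comp_right β.reverse (rel_comp_of_isPositive hR hrel hres hz p hα hβ)
    rw [Path.comp_assoc] at h
    exact (hequiv _ _).trans ((hequiv _ _).symm (hrel.comp_left p (hrel.comp_reverse β))) h
  exact (hequiv _ _).trans (key p) ((hequiv _ _).symm (key q))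

theorem HasFiniteCompleteRewritingSystem.hasFDT {S : Type*} [Mul S]
    (h : HasFiniteCompleteRewritingSystem S) : HasFDT S := by
  obtain ⟨A, hA, R, hfin, hR, hS⟩ := h
  exact ⟨A, hA, R, hfin, hS, hR.presentationHasFDT hfin⟩

end Squier

end SemigroupFDT

namespace SemigroupFDT

open Relation

/-! ### Criteria for termination and completeness. -/

section Criteria

variable {A : Type*} {R : RewritingSystem A}

theorem Step.mul {u v : FreeMonoid A} (h : Step R u v) (x y : FreeMonoid A) :
    Step R (x * u * y) (x * v * y) := by
  obtain ⟨r, hr, w₁, w₂, rfl, rfl⟩ := h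
  exact ⟨r, hr, x * w₁, w₂ * y, by simp only [mul_assoc], by simp only [mul_assoc]⟩

theorem reflTransGen_step_mul {u v : FreeMonoid A} (h : ReflTransGen (Step R) u v)
    (x y : FreeMonoid A) : ReflTransGen (Step R) (x * u * y) (x * v * y) :=
  h.lift (fun w => x * w * y) fun _ _ h => h.mul x y

theorem Step.of_mem {u v : FreeMonoid A} (h : (u, v) ∈ R) : Step R u v :=
  ⟨(u, v), h, 1, 1, by simp, by simp⟩

theorem Step.mk_eq {u v : FreeMonoid A} (h : Step R u v) :
    (PresentedMonoid.mk (fun u v => (u, v) ∈ R) u : MonoidOf R) = PresentedMonoid.mk _ v := by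
  obtain ⟨r, hr, w₁, w₂, rfl, rfl⟩ := h
  rw [map_mul, map_mul, map_mul, map_mul, PresentedMonoid.mk_eq_mk_of_rel (x := r.1) (y := r.2) hr]

theorem mk_eq_of_reflTransGen {u v : FreeMonoid A} (h : ReflTransGen (Step R) u v) :
    (PresentedMonoid.mk (fun u v => (u, v) ∈ R) u : MonoidOf R) = PresentedMonoid.mk _ v := by
  induction h with
  | refl => rfl
  | tail _ h ih => exact ih.trans h.mk_eq

/-- Termination by a strictly monotone interpretation of the letters on `ℕ`. -/
theorem isNoetherian_of_interpretation (i : A → ℕ → ℕ) (hi : ∀ a, StrictMono (i a))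
    (hR : ∀ r ∈ R, ∀ n, r.2.toList.foldr i n < r.1.toList.foldr i n) : IsNoetherian R := by
  have hmono : ∀ w : List A, StrictMono (w.foldr i) := fun w => by
    induction w with
    | nil => exact strictMono_id
    | cons a w ih => exact (hi a).comp ih
  rintro ⟨u, hu⟩
  refine not_strictAnti_of_wellFoundedLT (fun n => (u n).toList.foldr i 0)
    (strictAnti_nat_of_succ_lt fun n => ?_)
  obtain ⟨r, hr, w₁, w₂, h, h'⟩ := hu n
  simp only [h, h', FreeMonoid.toList_mul, List.foldr_append]
  exact hmono _ (hR r hr _)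

/-- A terminating rewriting system that reduces every word to a normal form of its value in `S`
is complete and presents `S`. -/
theorem hasFiniteCompleteRewritingSystem_of_normalForm {S : Type*} [Monoid S] {A : Type} [Finite A]
    {R : RewritingSystem A} (hfin : R.Finite) (hR : IsNoetherian R) (φ : FreeMonoid A →* S)
    (nf : S → FreeMonoid A) (hφ : ∀ r ∈ R, φ r.1 = φ r.2) (hnf : ∀ s, φ (nf s) = s)
    (hone : ReflTransGen (Step R) 1 (nf 1))
    (hmul : ∀ a s, ReflTransGen (Step R) (FreeMonoid.of a * nf s) (nf (φ (FreeMonoid.of a) * s))) :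
    HasFiniteCompleteRewritingSystem S := by
  -- Every word reduces to the normal form of its value, and the value is invariant under reduction.
  -- Both confluence and injectivity of the induced map follow.
  have hred : ∀ w, ReflTransGen (Step R) w (nf (φ w)) := fun w => by
    induction w using FreeMonoid.inductionOn' with
    | one => rwa [map_one]
    | of_mul a w ih =>
      rw [map_mul]
      refine .trans ?_ (hmul a (φ w))
      simpa using reflTransGen_step_mul ih (FreeMonoid.of a) 1
  have hstep : ∀ {u v}, ReflTransGen (Step R) u v → φ u = φ v := fun h => by
    induction h with
    | refl => rfl
    | tail _ h ih =>
      obtain ⟨r, hr, w₁, w₂, rfl, rfl⟩ := h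
      rw [ih, map_mul, map_mul, map_mul, map_mul, hφ r hr]
  refine ⟨A, inferInstance, R, hfin, ⟨hR, fun w u v hu hv => ⟨nf (φ w), ?_, ?_⟩⟩, ?_⟩
  · rw [hstep hu]; exact hred u
  · rw [hstep hv]; exact hred v
  · have hlift : FreeMonoid.lift (fun a => φ (FreeMonoid.of a)) = φ := FreeMonoid.lift_restrict φ
    let f : MonoidOf R →* S := PresentedMonoid.lift (fun a => φ (FreeMonoid.of a))
      fun u v h => by rw [hlift]; exact hφ (u, v) h
    have hf : ∀ w, f (PresentedMonoid.mk _ w) = φ w := fun w => DFunLike.congr_fun hlift w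
    refine ⟨(MulEquiv.ofBijective f ⟨fun x y h => ?_, fun s => ⟨PresentedMonoid.mk _ (nf s), ?_⟩⟩).symm⟩
    · induction x with | _ u =>
      induction y with | _ v =>
      rw [hf, hf] at h
      rw [mk_eq_of_reflTransGen (hred u), h, ← mk_eq_of_reflTransGen (hred v)]
    · rw [hf, hnf]

theorem HasFiniteCompleteRewritingSystem.congr {S S' : Type*} [Mul S] [Mul S']
    (h : HasFiniteCompleteRewritingSystem S) (e : S' ≃* S) :
    HasFiniteCompleteRewritingSystem S' := by
  obtain ⟨A, hA, R, hfin, hR, ⟨f⟩⟩ := h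
  exact ⟨A, hA, R, hfin, hR, ⟨e.trans f⟩⟩

theorem hasFiniteCompleteRewritingSystem_of_subsingleton (S : Type*) [Monoid S] [Subsingleton S] :
    HasFiniteCompleteRewritingSystem S :=
  hasFiniteCompleteRewritingSystem_of_normalForm (A := Empty) (R := ∅) Set.finite_empty
    (fun ⟨_, hu⟩ => by simpa [Step] using hu 0) 1 (fun _ => 1) (by simp)
    (fun _ => Subsingleton.elim _ _) .refl (fun a => a.elim)

end Criteria

/-! ### A complete system for the free group of rank two. -/

section FreeGroup

/-- The rules `x x⁻¹ → 1`; the letter `(x, true)` stands for `x` and `(x, false)` for `x⁻¹`. -/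
def cancelRules : RewritingSystem (Bool × Bool) :=
  Set.range fun p : Bool × Bool => (FreeMonoid.of p * FreeMonoid.of (p.1, !p.2), 1)

theorem reflTransGen_step_of_red {u v : List (Bool × Bool)} (h : FreeGroup.Red u v) :
    ReflTransGen (Step cancelRules) (FreeMonoid.ofList u) (FreeMonoid.ofList v) :=
  h.lift FreeMonoid.ofList fun _ _ h => by
    obtain @⟨L₁, L₂, x, b⟩ := h
    refine ⟨_, ⟨(x, b), rfl⟩, FreeMonoid.ofList L₁, FreeMonoid.ofList L₂, ?_, ?_⟩
    · change L₁ ++ _ = (L₁ ++ [(x, b), (x, !b)]) ++ L₂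
      simp
    · rw [mul_one]; rfl

theorem hasFiniteCompleteRewritingSystem_freeGroup :
    HasFiniteCompleteRewritingSystem (FreeGroup Bool) := by
  refine hasFiniteCompleteRewritingSystem_of_normalForm (R := cancelRules) (Set.finite_range _)
    (isNoetherian_of_interpretation (fun _ => Nat.succ) ?_ ?_)
    (FreeMonoid.lift fun p => FreeGroup.mk [p]) (fun s => FreeMonoid.ofList s.toWord) ?_ ?_ ?_ ?_
  · intro a m n h
    exact Nat.succ_lt_succ h
  · rintro _ ⟨p, rfl⟩ n
    simp
  · rintro _ ⟨⟨x, b⟩, rfl⟩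
    simp only [map_one, map_mul, FreeMonoid.lift_eval_of]
    rw [FreeGroup.mul_mk]
    exact Quot.sound (FreeGroup.Red.Step.not (L₁ := []) (L₂ := []))
  · have key : ∀ L : List (Bool × Bool), FreeMonoid.lift (fun p => FreeGroup.mk [p])
        (FreeMonoid.ofList L) = FreeGroup.mk L := fun L => by
      induction L with
      | nil => rfl
      | cons p L ih =>
        rw [FreeMonoid.ofList_cons, map_mul, ih, FreeMonoid.lift_eval_of, FreeGroup.mul_mk]; rfl
    intro s
    rw [key, FreeGroup.mk_toWord]
  · rw [FreeGroup.toWord_one]; exact .refl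
  · intro p s
    rw [FreeMonoid.lift_eval_of]
    refine (reflTransGen_step_of_red (FreeGroup.reduce.red (L := p :: s.toWord))).trans ?_
    conv_rhs => rw [← FreeGroup.mk_toWord (x := s)]
    rw [FreeGroup.mul_mk, FreeGroup.toWord_mk]
    exact .refl

end FreeGroup

/-! ### A complete system for `ℤ²`. -/

section FreeAbelian

/-- The free abelian group of rank two, written multiplicatively. -/
abbrev Z2 : Type := Multiplicative ℤ × Multiplicative ℤ

/-- The rules `x x⁻¹ → 1` and `b^ε a^δ → a^δ b^ε`, where `false` stands for `a` and `true`
for `b`. -/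
def commRules : RewritingSystem (Bool × Bool) :=
  cancelRules ∪ Set.range fun p : Bool × Bool =>
    (FreeMonoid.of (true, p.1) * FreeMonoid.of (false, p.2),
      FreeMonoid.of (false, p.2) * FreeMonoid.of (true, p.1))

/-- The exponent of a letter of sign `c`. -/
def signExp (c : Bool) : ℤ := if c then 1 else -1

/-- The reduced word for the power `x ^ m`. -/
def powWord (x : Bool) (m : ℤ) : FreeMonoid (Bool × Bool) :=
  FreeMonoid.of (x, decide (0 ≤ m)) ^ m.natAbs

theorem powWord_natCast (x : Bool) (k : ℕ) : powWord x k = FreeMonoid.of (x, true) ^ k := by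
  simp [powWord]

theorem powWord_neg_natCast (x : Bool) (k : ℕ) : powWord x (-k) = FreeMonoid.of (x, false) ^ k := by
  rcases k with _ | k
  · simp [powWord]
  · have : ¬ (0 : ℤ) ≤ -((k + 1 : ℕ) : ℤ) := by push_cast; omega
    simp only [powWord, this, decide_false, Int.natAbs_neg, Int.natAbs_natCast]

theorem step_cancel (x c : Bool) (w : FreeMonoid (Bool × Bool)) :
    Step commRules (FreeMonoid.of (x, c) * (FreeMonoid.of (x, !c) * w)) w :=
  ⟨_, .inl ⟨(x, c), rfl⟩, 1, w, by simp [mul_assoc], by simp⟩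

theorem reflTransGen_powWord (x c : Bool) (m : ℤ) :
    ReflTransGen (Step commRules) (FreeMonoid.of (x, c) * powWord x m)
      (powWord x (signExp c + m)) := by
  obtain ⟨k, rfl | rfl⟩ := m.eq_nat_or_neg
  · rw [powWord_natCast]
    cases c with
    | true =>
      rw [← pow_succ', ← powWord_natCast, signExp, if_pos rfl, Nat.cast_succ, add_comm]
    | false =>
      rcases k with _ | k
      · rw [pow_zero, mul_one]
        exact .refl
      · have : signExp false + ((k + 1 : ℕ) : ℤ) = k := by simp [signExp]
        rw [this, pow_succ', powWord_natCast]
        exact .single (step_cancel x false _)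
  · rw [powWord_neg_natCast]
    cases c with
    | false =>
      rw [← pow_succ', ← powWord_neg_natCast, Nat.cast_succ, neg_add_rev]
      exact .refl
    | true =>
      rcases k with _ | k
      · rw [pow_zero, mul_one]
        exact .refl
      · have : signExp true + -((k + 1 : ℕ) : ℤ) = -k := by simp [signExp]
        rw [this, pow_succ', powWord_neg_natCast]
        exact .single (step_cancel x true _)

theorem reflTransGen_comm (c d : Bool) (k : ℕ) :
    ReflTransGen (Step commRules) (FreeMonoid.of (true, c) * FreeMonoid.of (false, d) ^ k)
      (FreeMonoid.of (false, d) ^ k * FreeMonoid.of (true, c)) := by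
  induction k with
  | zero => rw [pow_zero, mul_one, one_mul]
  | succ k ih =>
    rw [pow_succ']
    have h : Step commRules (FreeMonoid.of (true, c) * FreeMonoid.of (false, d))
      (FreeMonoid.of (false, d) * FreeMonoid.of (true, c)) := .of_mem (.inr ⟨(c, d), rfl⟩)
    have h₁ := h.mul 1 (FreeMonoid.of (false, d) ^ k)
    have h₂ := reflTransGen_step_mul ih (FreeMonoid.of (false, d)) 1
    simp only [one_mul, mul_one, mul_assoc] at h₁ h₂ ⊢
    exact .head h₁ h₂

/-- The image of a generator in `Z2`. -/
def genZ2 (x : Bool) : Z2 := if x then (1, .ofAdd 1) else (.ofAdd 1, 1)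

theorem hasFiniteCompleteRewritingSystem_Z2 : HasFiniteCompleteRewritingSystem Z2 := by
  refine hasFiniteCompleteRewritingSystem_of_normalForm (R := commRules)
    ((Set.finite_range _).union (Set.finite_range _))
    -- `foldr` applies the leftmost letter last, so `ba` evaluates to `2n + 3` but `ab` only to `2n
    -- + 2`.
    (isNoetherian_of_interpretation (fun p n => if p.1 then 2 * n + 1 else n + 1)
      ?_ ?_)
    (FreeMonoid.lift fun p => genZ2 p.1 ^ signExp p.2)
    (fun s => powWord false s.1.toAdd * powWord true s.2.toAdd) ?_ ?_ ?_ ?_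
  · rintro ⟨x, c⟩ m n h
    cases x <;> simp <;> omega
  · rintro _ (⟨⟨x, c⟩, rfl⟩ | ⟨⟨c, d⟩, rfl⟩) n
    · cases x <;> simp
      omega
    · simp; omega
  · rintro _ (⟨⟨x, c⟩, rfl⟩ | ⟨⟨c, d⟩, rfl⟩)
    · simp only [map_one, map_mul, FreeMonoid.lift_eval_of]
      cases c <;> simp [signExp]
    · simp only [map_mul, FreeMonoid.lift_eval_of]
      exact mul_comm _ _
  · have key : ∀ (x : Bool) (m : ℤ), FreeMonoid.lift (fun p : Bool × Bool => genZ2 p.1 ^ signExp p.2)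
        (powWord x m) = genZ2 x ^ m := fun x m => by
      obtain ⟨k, rfl | rfl⟩ := m.eq_nat_or_neg
      · simp [powWord_natCast, signExp]
      · simp [powWord_neg_natCast, signExp]
    intro s
    rw [map_mul, key, key]
    ext <;> simp [genZ2]
  · exact .refl
  · rintro ⟨x, c⟩ ⟨m, n⟩
    rw [FreeMonoid.lift_eval_of]
    cases x with
    | false =>
      have h := reflTransGen_step_mul (reflTransGen_powWord false c m.toAdd) 1
        (powWord true n.toAdd)
      simpa [genZ2, mul_assoc] using h
    | true =>
      -- A letter `b^±` first moves past the block of `a`'s and is then absorbed into the power of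
      -- `b`.
      have h₁ := reflTransGen_step_mul (reflTransGen_comm c (decide (0 ≤ m.toAdd)) m.toAdd.natAbs) 1
        (powWord true n.toAdd)
      have h₂ := reflTransGen_step_mul (reflTransGen_powWord true c n.toAdd)
        (powWord false m.toAdd) 1
      simp only [one_mul, mul_one, mul_assoc] at h₁ h₂
      rw [← mul_assoc] at h₁
      simpa [genZ2, powWord, mul_assoc] using h₁.trans h₂

end FreeAbelian

end SemigroupFDT

/-! ### Normal forms for `M`. -/

namespace SemigroupFDT

/-- The abelianisation map of the free group of rank two. -/
def ab : FreeGroup Bool →* Z2 := FreeGroup.lift genZ2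

/-- The word `a ^ m b ^ n`. -/
def abSection (v : Z2) : FreeGroup Bool :=
  FreeGroup.of false ^ v.1.toAdd * FreeGroup.of true ^ v.2.toAdd

theorem ab_abSection (v : Z2) : ab (abSection v) = v := by
  ext <;> simp [ab, abSection, genZ2]

/-- The normal forms of the elements of `M`: those of `F ∪ hℤ² ∪ {h²}`. -/
inductive Model : Type
  | unit (g : FreeGroup Bool)
  | mid (v : Z2)
  | zero

namespace Model

/-- Multiplication of normal forms. -/
protected def mul : Model → Model → Model
  | unit g, unit k => unit (g * k)
  | unit g, mid v => mid (ab g * v)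
  | mid v, unit g => mid (v * ab g)
  | _, _ => zero

instance : Monoid Model where
  mul := Model.mul
  one := unit 1
  mul_assoc := by
    rintro (g | v | _) (g' | v' | _) (g'' | v'' | _) <;>
    first
      | rfl
      | exact congrArg unit (mul_assoc _ _ _)
      | exact congrArg mid (mul_assoc _ _ _)
      | exact congrArg mid (by rw [map_mul, mul_assoc])
  one_mul := by
    rintro (g | v | _)
    · exact congrArg unit (one_mul _)
    · exact congrArg mid (by rw [map_one, one_mul])
    · rfl
  mul_one := by
    rintro (g | v | _)
    · exact congrArg unit (mul_one _)
    · exact congrArg mid (by rw [map_one, mul_one])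
    · rfl

theorem one_def : (1 : Model) = unit 1 := rfl
theorem unit_mul_unit (g k : FreeGroup Bool) : unit g * unit k = unit (g * k) := rfl
theorem unit_mul_mid (g : FreeGroup Bool) (v : Z2) : unit g * mid v = mid (ab g * v) := rfl
theorem mid_mul_unit (g : FreeGroup Bool) (v : Z2) : mid v * unit g = mid (v * ab g) := rfl
theorem zero_mul (x : Model) : zero * x = zero := by cases x <;> rfl

end Model

/-- The free group element of a letter, `1` for the letter `h`. -/
def Letter.group : Letter → FreeGroup Bool
  | .a => .of false
  | .aInv => (.of false)⁻¹
  | .b => .of true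
  | .bInv => (.of true)⁻¹
  | .h => 1

/-- The normal form of a letter. -/
def Letter.model : Letter → Model
  | .h => .mid 1
  | x => .unit x.group

theorem Letter.model_of_ne {x : Letter} (hx : x ≠ .h) : x.model = .unit x.group := by
  cases x <;> first | rfl | exact absurd rfl hx

open Model in
/-- The normal form of an element of `M`. -/
def toModel : M →* Model := PresentedMonoid.lift Letter.model <| by
  rintro u v ((((h | ⟨x, hx, h⟩) | ⟨x, y, hx, hy, h⟩) | ⟨x, hx, h⟩) | h)
  · simp only [Set.mem_insert_iff, Set.mem_singleton_iff, Prod.mk.injEq] at h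
    rcases h with ⟨rfl, rfl⟩ | ⟨rfl, rfl⟩ | ⟨rfl, rfl⟩ | ⟨rfl, rfl⟩ <;>
    simp [Letter.word, Letter.model, Letter.group, unit_mul_unit, one_def]
  all_goals obtain ⟨rfl, rfl⟩ := Prod.mk.inj h
  · simp only [Letter.word, map_mul, FreeMonoid.lift_eval_of, Letter.model_of_ne hx]
    exact congrArg mid (mul_comm _ _)
  · simp only [Letter.word, map_mul, FreeMonoid.lift_eval_of, Letter.model_of_ne hx,
      Letter.model_of_ne hy, mul_assoc]
    exact congrArg mid (by rw [map_mul, map_mul, mul_comm (ab _)])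
  · simp only [Letter.word, map_mul, FreeMonoid.lift_eval_of, Letter.model_of_ne hx]
    rfl
  · rfl

/-- The element of `M` of a letter. -/
def Letter.gen (x : Letter) : M := PresentedMonoid.of _ x

theorem toModel_gen (x : Letter) : toModel x.gen = x.model := rfl

theorem mk_eq_of_mem {u v : FreeMonoid Letter} (h : (u, v) ∈ relationsM) :
    (PresentedMonoid.mk _ u : M) = PresentedMonoid.mk _ v :=
  PresentedMonoid.mk_eq_mk_of_rel h

open Letter

theorem gen_mul_h {x : Letter} (hx : x ≠ h) : x.gen * h.gen = h.gen * x.gen :=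
  mk_eq_of_mem (.inl (.inl (.inl (.inr ⟨x, hx, rfl⟩))))

theorem h_mul_gen_mul_gen {x y : Letter} (hx : x ≠ h) (hy : y ≠ h) :
    h.gen * x.gen * y.gen = h.gen * y.gen * x.gen :=
  mk_eq_of_mem (.inl (.inl (.inr ⟨x, y, hx, hy, rfl⟩)))

theorem h_mul_h_mul_gen {x : Letter} (hx : x ≠ h) : h.gen * h.gen * x.gen = h.gen * h.gen :=
  mk_eq_of_mem (.inl (.inr ⟨x, hx, rfl⟩))

theorem h_mul_h_mul_h : h.gen * h.gen * h.gen = h.gen * h.gen :=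
  mk_eq_of_mem (.inr rfl)

/-- The generator `a` or `b` as a unit of `M`. -/
def unitGen (x : Bool) : Mˣ :=
  if x then ⟨b.gen, bInv.gen, mk_eq_of_mem (.inl (.inl (.inl (.inl (by simp [Letter.word]))))),
    mk_eq_of_mem (.inl (.inl (.inl (.inl (by simp [Letter.word])))))⟩
  else ⟨a.gen, aInv.gen, mk_eq_of_mem (.inl (.inl (.inl (.inl (by simp [Letter.word]))))),
    mk_eq_of_mem (.inl (.inl (.inl (.inl (by simp [Letter.word])))))⟩

/-- The embedding of the free group in `M`. -/
def ofGroup : FreeGroup Bool →* M := (Units.coeHom M).comp (FreeGroup.lift unitGen)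

theorem ofGroup_group {x : Letter} (hx : x ≠ h) : ofGroup x.group = x.gen := by
  cases x <;> first
    | exact absurd rfl hx
    | simp [ofGroup, Letter.group, unitGen]; done
    | simp [ofGroup, Letter.group, unitGen]; rfl

/-- Induction over the words in `a, a⁻¹, b, b⁻¹`. -/
theorem group_induction {p : FreeGroup Bool → Prop} (one : p 1)
    (letter : ∀ x : Letter, x ≠ h → p x.group) (mul : ∀ g k, p g → p k → p (g * k))
    (g : FreeGroup Bool) : p g :=
  FreeGroup.induction_on g one
    (fun x => x.casesOn (letter a (by simp)) (letter b (by simp)))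
    (fun x _ => x.casesOn (letter aInv (by simp)) (letter bInv (by simp))) mul

theorem ofGroup_mul_h (g : FreeGroup Bool) : ofGroup g * h.gen = h.gen * ofGroup g := by
  induction g using group_induction with
  | one => simp
  | letter x hx => rw [ofGroup_group hx, gen_mul_h hx]
  | mul g k hg hk => rw [map_mul, mul_assoc, hk, ← mul_assoc, hg, mul_assoc]

/-- Commuting with `z` behind `h` passes to products, because `h` can be moved through `x` to stand
before the second factor. -/
theorem h_mul_mul_comm_right {x y z : M} (hx : x * h.gen = h.gen * x)
    (hy : h.gen * (z * x) = h.gen * (x * z)) (hz : h.gen * (z * y) = h.gen * (y * z)) :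
    h.gen * (z * (x * y)) = h.gen * (x * y * z) := by
  rw [← mul_assoc z, ← mul_assoc, hy, ← mul_assoc, ← hx, mul_assoc, mul_assoc, hz,
    ← mul_assoc x, hx, mul_assoc, mul_assoc]

theorem h_mul_ofGroup_mul_comm (g k : FreeGroup Bool) :
    h.gen * ofGroup (g * k) = h.gen * ofGroup (k * g) := by
  rw [map_mul, map_mul]
  induction k using group_induction with
  | one => simp
  | mul k k' hk hk' =>
    rw [map_mul]
    exact h_mul_mul_comm_right (ofGroup_mul_h k) hk hk'
  | letter y hy =>
    induction g using group_induction with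
    | one => simp
    | mul g g' hg hg' =>
      rw [map_mul]
      exact (h_mul_mul_comm_right (ofGroup_mul_h g) hg.symm hg'.symm).symm
    | letter x hx =>
      rw [ofGroup_group hx, ofGroup_group hy, ← mul_assoc, ← mul_assoc, h_mul_gen_mul_gen hx hy]

theorem h_mul_ofGroup_swap (p x y q : FreeGroup Bool) :
    h.gen * ofGroup (p * x * y * q) = h.gen * ofGroup (p * y * x * q) := by
  have key : ∀ z : FreeGroup Bool, h.gen * ofGroup (p * z * q) =
      ofGroup p * (h.gen * ofGroup z) * ofGroup q := fun z => by
    rw [map_mul, map_mul, ← mul_assoc, ← mul_assoc, ← mul_assoc, ofGroup_mul_h]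
  rw [mul_assoc p x, mul_assoc p y, key, key, h_mul_ofGroup_mul_comm]

/-- Behind `h` all factors commute, so only the exponents of `a` and `b` matter. -/
theorem h_mul_ofGroup_abSection (g : FreeGroup Bool) :
    h.gen * ofGroup (abSection (ab g)) = h.gen * ofGroup g := by
  induction g using group_induction with
  | one => simp [abSection]
  | letter x hx => cases x <;> simp [abSection, ab, genZ2, Letter.group] at hx ⊢
  | mul g k hg hk =>
    have : abSection (ab (g * k)) = FreeGroup.of false ^ (ab g).1.toAdd *
        FreeGroup.of false ^ (ab k).1.toAdd * FreeGroup.of true ^ (ab g).2.toAdd *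
        FreeGroup.of true ^ (ab k).2.toAdd := by
      simp only [abSection, map_mul, Prod.fst_mul, Prod.snd_mul, toAdd_mul, zpow_add, mul_assoc]
    -- Interchanging the two middle powers separates the sections of `g` and `k`.
    rw [this, h_mul_ofGroup_swap]
    rw [mul_assoc, ← abSection, ← abSection, map_mul, ← mul_assoc, hg, ← ofGroup_mul_h, mul_assoc,
      hk, ← mul_assoc, ofGroup_mul_h, mul_assoc, ← map_mul]

theorem h_mul_h_mul_ofGroup (g : FreeGroup Bool) :
    h.gen * h.gen * ofGroup g = h.gen * h.gen := by
  induction g using group_induction with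
  | one => simp
  | letter x hx => rw [ofGroup_group hx, h_mul_h_mul_gen hx]
  | mul g k hg hk => rw [map_mul, ← mul_assoc, hg, hk]

theorem ofGroup_mul_h_mul_h (g : FreeGroup Bool) :
    ofGroup g * (h.gen * h.gen) = h.gen * h.gen := by
  rw [← mul_assoc, ofGroup_mul_h, mul_assoc, ofGroup_mul_h, ← mul_assoc, h_mul_h_mul_ofGroup]

/-- The element of `M` with a given normal form. -/
def ofModel : Model → M
  | .unit g => ofGroup g
  | .mid v => h.gen * ofGroup (abSection v)
  | .zero => h.gen * h.gen

/-- This drives the induction on words showing that every element of `M` equals its normal form. -/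
theorem gen_mul_ofModel (x : Letter) (y : Model) : x.gen * ofModel y = ofModel (x.model * y) := by
  by_cases hx : x = h
  · subst hx
    rcases y with g | v | _
    · change h.gen * ofGroup g = h.gen * ofGroup (abSection (1 * ab g))
      rw [one_mul, h_mul_ofGroup_abSection]
    · change h.gen * (h.gen * ofGroup _) = h.gen * h.gen
      rw [← mul_assoc, h_mul_h_mul_ofGroup]
    · change h.gen * (h.gen * h.gen) = h.gen * h.gen
      rw [← mul_assoc, h_mul_h_mul_h]
  · rw [Letter.model_of_ne hx, ← ofGroup_group hx]
    rcases y with g | v | _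
    · exact (map_mul ofGroup _ _).symm
    · change ofGroup x.group * (h.gen * ofGroup (abSection v)) =
        h.gen * ofGroup (abSection (ab x.group * v))
      rw [show ab x.group * v = ab (x.group * abSection v) by rw [map_mul, ab_abSection],
        h_mul_ofGroup_abSection, ← mul_assoc, ofGroup_mul_h, mul_assoc, map_mul]
    · exact ofGroup_mul_h_mul_h _

theorem ofModel_toModel (m : M) : ofModel (toModel m) = m := by
  induction m using PresentedMonoid.inductionOn with | _ w =>
  induction w using FreeMonoid.inductionOn' with
  | one => exact map_one ofGroup
  | of_mul x w ih =>
    rw [map_mul, map_mul]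
    conv_rhs => rw [← ih]
    exact (gen_mul_ofModel x _).symm

theorem toModel_ofGroup (g : FreeGroup Bool) : toModel (ofGroup g) = .unit g := by
  induction g using group_induction with
  | one => rw [map_one, map_one]; rfl
  | letter x hx => rw [ofGroup_group hx, toModel_gen, Letter.model_of_ne hx]
  | mul g k hg hk => rw [map_mul, map_mul, hg, hk]; rfl

theorem toModel_ofModel (y : Model) : toModel (ofModel y) = y := by
  rcases y with g | v | _
  · exact toModel_ofGroup g
  · change toModel (h.gen * ofGroup _) = _
    rw [map_mul, toModel_ofGroup, toModel_gen]
    change Model.mid (1 * _) = _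
    rw [one_mul, ab_abSection]
  · rfl

/-- `M` is the monoid of normal forms. -/
def modelEquiv : M ≃* Model where
  toFun := toModel
  invFun := ofModel
  left_inv := ofModel_toModel
  right_inv := toModel_ofModel
  map_mul' := map_mul toModel

end SemigroupFDT

/-! ### Units, relative classes and Schützenberger groups of `M`. -/

namespace SemigroupFDT

open scoped Pointwise

theorem isUnit_ofGroup (g : FreeGroup Bool) : IsUnit (ofGroup g) := Units.isUnit _

theorem toModel_injective : Function.Injective toModel := modelEquiv.injective

/-- Levels never decrease in products, so an element of positive level has no inverse. -/
theorem isUnit_iff {m : M} : IsUnit m ↔ ∃ g, ofGroup g = m := by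
  refine ⟨fun ⟨u, hu⟩ => ?_, fun ⟨g, hg⟩ => hg ▸ isUnit_ofGroup g⟩
  have h : toModel m * toModel (↑u⁻¹ : M) = Model.unit 1 := by
    rw [← map_mul, ← hu, Units.mul_inv, map_one]; rfl
  rcases hm : toModel m with g | v | _
  · exact ⟨g, toModel_injective ((toModel_ofGroup g).trans hm.symm)⟩
  · rw [hm] at h
    generalize toModel (↑u⁻¹ : M) = y at h
    rcases y <;> cases h
  · rw [hm, Model.zero_mul] at h
    cases h

theorem mem_unitsM {m : M} : m ∈ unitsM ↔ ∃ g, ofGroup g = m := isUnit_iff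

theorem ofGroup_mem_unitsM (g : FreeGroup Bool) : ofGroup g ∈ unitsM := mem_unitsM.2 ⟨g, rfl⟩

/-- The group of units of `M` is free of rank two. -/
theorem nonempty_unitsM_mulEquiv : Nonempty (unitsM ≃* FreeGroup Bool) := by
  let f : FreeGroup Bool →ₙ* unitsM :=
    { toFun := fun g => ⟨ofGroup g, ofGroup_mem_unitsM g⟩
      map_mul' := fun g k => Subtype.ext (map_mul ofGroup g k) }
  refine ⟨(MulEquiv.ofBijective f ⟨fun g k h => ?_, fun ⟨m, hm⟩ => ?_⟩).symm⟩
  · have := congrArg toModel (Subtype.ext_iff.1 h)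
    change toModel (ofGroup g) = toModel (ofGroup k) at this
    rw [toModel_ofGroup, toModel_ofGroup] at this
    exact Model.unit.inj this
  · obtain ⟨g, rfl⟩ := mem_unitsM.1 hm
    exact ⟨g, rfl⟩

theorem coe_mem_adjoinOne {g : FreeGroup Bool} : ((ofGroup g : M) : WithOne M) ∈ adjoinOne unitsM :=
  .inr ⟨_, ofGroup_mem_unitsM g, rfl⟩

/-- The value in `M` of an element of `M¹`. -/
def valM : WithOne M →* M := WithOne.lift (MulHom.id M)

theorem coe_mul_eq (m : M) (x : WithOne M) : (m : WithOne M) * x = ((m * valM x : M) : WithOne M) := by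
  refine WithOne.cases_on x ?_ fun x => rfl
  rw [mul_one, map_one, mul_one]

theorem mul_coe_eq (m : M) (x : WithOne M) : x * (m : WithOne M) = ((valM x * m : M) : WithOne M) := by
  refine WithOne.cases_on x ?_ fun x => rfl
  rw [one_mul, map_one, one_mul]

theorem valM_of_mem {x : WithOne M} (hx : x ∈ adjoinOne unitsM) : ∃ g, valM x = ofGroup g := by
  rcases hx with rfl | ⟨t, ht, rfl⟩
  · exact ⟨1, by rw [map_one, map_one]⟩
  · obtain ⟨g, rfl⟩ := mem_unitsM.1 ht
    exact ⟨g, rfl⟩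

theorem singleton_mul_adjoinOne (u : M) : ({(u : WithOne M)} : Set (WithOne M)) *
    (adjoinOne unitsM : Set (WithOne M)) = Set.range fun g => ((u * ofGroup g : M) : WithOne M) := by
  ext w
  rw [Set.singleton_mul]
  constructor
  · rintro ⟨x, hx, rfl⟩
    obtain ⟨g, hg⟩ := valM_of_mem hx
    exact ⟨g, by simp only [coe_mul_eq, hg]⟩
  · rintro ⟨g, rfl⟩
    exact ⟨_, coe_mem_adjoinOne, WithOne.coe_mul _ _⟩

theorem adjoinOne_mul_singleton (u : M) : (adjoinOne unitsM : Set (WithOne M)) *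
    ({(u : WithOne M)} : Set (WithOne M)) = Set.range fun g => ((ofGroup g * u : M) : WithOne M) := by
  ext w
  rw [Set.mul_singleton]
  constructor
  · rintro ⟨x, hx, rfl⟩
    obtain ⟨g, hg⟩ := valM_of_mem hx
    exact ⟨g, by simp only [mul_coe_eq, hg]⟩
  · rintro ⟨g, rfl⟩
    exact ⟨_, coe_mem_adjoinOne, WithOne.coe_mul _ _⟩

/-- `T` already contains the identity of `M`, so the adjoined one adds nothing: `uT¹` is the orbit
of `u` under the units. -/
theorem relR_iff {u v : M} : RelR unitsM u v ↔ ∃ g, u = v * ofGroup g := by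
  rw [RelR, singleton_mul_adjoinOne, singleton_mul_adjoinOne]
  constructor
  · intro h
    have : ((u * ofGroup 1 : M) : WithOne M) ∈ Set.range fun g => ((u * ofGroup g : M) : WithOne M) :=
      ⟨1, rfl⟩
    rw [h] at this
    obtain ⟨g, hg⟩ := this
    exact ⟨g, by simpa using (WithOne.coe_injective hg).symm⟩
  · rintro ⟨g, rfl⟩
    refine (Equiv.mulLeft g).surjective.range_comp _ |>.symm.trans ?_ |>.symm
    simp [Function.comp_def, mul_assoc]

theorem relL_iff {u v : M} : RelL unitsM u v ↔ ∃ g, u = ofGroup g * v := by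
  rw [RelL, adjoinOne_mul_singleton, adjoinOne_mul_singleton]
  constructor
  · intro h
    have : ((ofGroup 1 * u : M) : WithOne M) ∈ Set.range fun g => ((ofGroup g * u : M) : WithOne M) :=
      ⟨1, rfl⟩
    rw [h] at this
    obtain ⟨g, hg⟩ := this
    exact ⟨g, by simpa using (WithOne.coe_injective hg).symm⟩
  · rintro ⟨g, rfl⟩
    refine (Equiv.mulRight g).surjective.range_comp _ |>.symm.trans ?_ |>.symm
    simp [Function.comp_def, mul_assoc]

/-- The `ℋ^T`-class `hℤ²`. -/
def midClass : Set M := {m | ∃ v, toModel m = .mid v}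

/-- The `ℋ^T`-class of the zero `h²` of `M`. -/
def zeroClass : Set M := {m | toModel m = .zero}

/-- Units act on `hℤ²` by translation through the surjection `ab`, transitively from either side,
and they fix the zero. -/
theorem eq_of_mem_outerHClasses {H : Set M} (hH : H ∈ outerHClasses unitsM) :
    H = midClass ∨ H = zeroClass := by
  obtain ⟨⟨y, rfl⟩, hH⟩ := hH
  have hy : y ∉ unitsM := hH ((relH unitsM).refl y)
  have hrel : ∀ x, (relH unitsM) x y ↔
      (∃ g, toModel x = toModel y * .unit g) ∧ ∃ g, toModel x = .unit g * toModel y := fun x => by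
    simp only [← toModel_ofGroup, ← map_mul, toModel_injective.eq_iff]
    exact and_congr relR_iff relL_iff
  rcases hm : toModel y with g | v | _
  · exact absurd (mem_unitsM.2 ⟨g, toModel_injective ((toModel_ofGroup g).trans hm.symm)⟩) hy
  · left
    ext x
    refine (hrel x).trans ?_
    rw [hm]
    constructor
    · rintro ⟨⟨g, hg⟩, -⟩
      exact ⟨_, hg⟩
    · rintro ⟨w, hw⟩
      refine ⟨⟨abSection (v⁻¹ * w), ?_⟩, ⟨abSection (w * v⁻¹), ?_⟩⟩
      · rw [hw, Model.mid_mul_unit, ab_abSection, mul_inv_cancel_left]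
      · rw [hw, Model.unit_mul_mid, ab_abSection, inv_mul_cancel_right]
  · right
    ext x
    refine (hrel x).trans ?_
    rw [hm]
    constructor
    · rintro ⟨⟨g, hg⟩, -⟩
      exact hg
    · intro hx
      exact ⟨⟨1, hx⟩, ⟨1, hx⟩⟩

theorem greenIndex_lt_top : greenIndex unitsM < ⊤ := by
  have : (outerHClasses unitsM).Finite :=
    (Set.toFinite {midClass, zeroClass}).subset fun H hH => eq_of_mem_outerHClasses hH
  rw [greenIndex]
  exact WithTop.add_lt_top.2 ⟨this.encard_lt_top, ENat.natCast_lt_top 1⟩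

theorem subsingleton_schutzenbergerGroup_zero :
    Subsingleton (SchutzenbergerGroup unitsM zeroClass) := by
  refine ⟨fun x y => ?_⟩
  induction x using Con.induction_on with | _ x =>
  induction y using Con.induction_on with | _ y =>
  refine (Con.eq _).2 fun z hz => ?_
  have hz' : toModel z = .zero := hz
  rw [coe_mul_eq, coe_mul_eq]
  refine congrArg _ (toModel_injective ?_)
  rw [map_mul, map_mul, hz', Model.zero_mul, Model.zero_mul]

/-- The image in `Z2` of a unit. -/
def Model.abValue : Model → Z2
  | .unit g => ab g
  | _ => 1

/-- The action of `Stab(hℤ²)` on `hℤ²`. -/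
def stabHom : stab unitsM midClass →* Z2 where
  toFun x := (toModel (valM x)).abValue
  map_one' := by
    rw [Submonoid.coe_one, map_one, map_one]
    exact map_one ab
  map_mul' x y := by
    obtain ⟨g, hg⟩ := valM_of_mem x.2.1
    obtain ⟨k, hk⟩ := valM_of_mem y.2.1
    rw [Submonoid.coe_mul, map_mul, map_mul, hg, hk, toModel_ofGroup, toModel_ofGroup]
    exact map_mul ab g k

/-- Translations of `ℤ²` that agree at one point are equal. -/
theorem schutzenbergerCon_midClass : schutzenbergerCon unitsM midClass = Con.ker stabHom := by
  ext x y
  obtain ⟨g, hg⟩ := valM_of_mem x.2.1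
  obtain ⟨k, hk⟩ := valM_of_mem y.2.1
  have hxy : stabHom x = stabHom y ↔ ab g = ab k := by
    change (toModel (valM x)).abValue = (toModel (valM y)).abValue ↔ _
    rw [hg, hk, toModel_ofGroup, toModel_ofGroup]; rfl
  have hact : ∀ {z : M} {v : Z2}, toModel z = .mid v →
      ((z : WithOne M) * (x : WithOne M) = (z : WithOne M) * (y : WithOne M) ↔ ab g = ab k) := by
    intro z v hz
    rw [coe_mul_eq, coe_mul_eq, WithOne.coe_inj, ← toModel_injective.eq_iff, map_mul, map_mul, hg,
      hk, toModel_ofGroup, toModel_ofGroup, hz, Model.mid_mul_unit, Model.mid_mul_unit,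
      Model.mid.injEq, mul_right_inj]
  rw [Con.ker_rel, hxy]
  constructor
  · intro h
    have hz : toModel (ofModel (.mid 1)) = .mid 1 := toModel_ofModel _
    exact (hact hz).1 (h _ ⟨1, hz⟩)
  · rintro h z ⟨v, hz⟩
    exact (hact hz).2 h

theorem stabHom_surjective : Function.Surjective stabHom := by
  intro v
  refine ⟨⟨(ofGroup (abSection v) : M), coe_mem_adjoinOne, ?_⟩, ?_⟩
  · ext w
    rw [Set.mul_singleton, Set.image_image]
    constructor
    · rintro ⟨m, ⟨u, hu⟩, rfl⟩
      refine ⟨m * ofGroup (abSection v), ⟨u * v, ?_⟩, rfl⟩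
      rw [map_mul, hu, toModel_ofGroup, Model.mid_mul_unit, ab_abSection]
    · rintro ⟨m, ⟨u, hu⟩, rfl⟩
      refine ⟨m * ofGroup (abSection v)⁻¹, ⟨u * v⁻¹, ?_⟩, ?_⟩
      · rw [map_mul, hu, toModel_ofGroup, Model.mid_mul_unit, map_inv, ab_abSection]
      · change ((m * ofGroup _ * ofGroup _ : M) : WithOne M) = m
        rw [mul_assoc, ← map_mul, inv_mul_cancel, map_one, mul_one]
  · change (toModel (ofGroup _)).abValue = v
    rw [toModel_ofGroup]
    exact ab_abSection v

theorem hasFiniteCompleteRewritingSystem_schutzenbergerGroup {H : Set M}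
    (hH : H ∈ outerHClasses unitsM) :
    HasFiniteCompleteRewritingSystem (SchutzenbergerGroup unitsM H) := by
  rcases eq_of_mem_outerHClasses hH with rfl | rfl
  · refine hasFiniteCompleteRewritingSystem_Z2.congr ?_
    change (schutzenbergerCon unitsM midClass).Quotient ≃* Z2
    rw [schutzenbergerCon_midClass]
    exact Con.quotientKerEquivOfSurjective stabHom stabHom_surjective
  · have := subsingleton_schutzenbergerGroup_zero
    exact hasFiniteCompleteRewritingSystem_of_subsingleton _

theorem hasFiniteCompleteRewritingSystem_unitsM : HasFiniteCompleteRewritingSystem unitsM :=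
  hasFiniteCompleteRewritingSystem_freeGroup.congr nonempty_unitsM_mulEquiv.some

end SemigroupFDT

namespace SemigroupFDT

open Quiver

/-! ### Labelling paths of a derivation graph by group elements. -/

section Label

variable {A : Type*} {R : RewritingSystem A} {L : Type*} [Group L]

/-- The label of an edge, for a labelling of the rules by elements of a group. -/
def edgeLabel (k : R → L) {u v : Vertex R} (e : u ⟶ v) : L :=
  if DerivationEdge.sign e then k (DerivationEdge.rule e) else (k (DerivationEdge.rule e))⁻¹

/-- The product of the labels along a path. -/
def pathLabel (k : R → L) {u : Vertex R} : ∀ {v : Vertex R}, Path u v → L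
  | _, .nil => 1
  | _, .cons p e => pathLabel k p * edgeLabel k e

variable (k : R → L)

theorem pathLabel_comp {u v w : Vertex R} (p : Path u v) (q : Path v w) :
    pathLabel k (p.comp q) = pathLabel k p * pathLabel k q := by
  induction q with
  | nil => exact (mul_one _).symm
  | cons q e ih =>
    rw [Path.comp_cons, pathLabel, pathLabel, ih, mul_assoc]

theorem pathLabel_toPath {u v : Vertex R} (e : u ⟶ v) : pathLabel k e.toPath = edgeLabel k e :=
  one_mul _

theorem edgeLabel_reverse {u v : Vertex R} (e : u ⟶ v) :
    edgeLabel k (reverse e) = (edgeLabel k e)⁻¹ := by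
  change (if !DerivationEdge.sign e then k (DerivationEdge.rule e)
    else (k (DerivationEdge.rule e))⁻¹) = (edgeLabel k e)⁻¹
  rw [edgeLabel]
  cases DerivationEdge.sign e <;> simp

theorem pathLabel_reverse {u v : Vertex R} (p : Path u v) :
    pathLabel k p.reverse = (pathLabel k p)⁻¹ := by
  induction p with
  | nil => exact inv_one.symm
  | cons p e ih =>
    rw [Path.reverse, pathLabel_comp, pathLabel_toPath, ih, edgeLabel_reverse, pathLabel,
      mul_inv_rev]

theorem pathLabel_actLeft (x : Vertex R) {u v : Vertex R} (p : Path u v) :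
    pathLabel k ((actLeft x).mapPath p) = pathLabel k p := by
  induction p with
  | nil => rfl
  | cons p e ih => exact congrArg (· * edgeLabel k e) ih

theorem pathLabel_actRight (x : Vertex R) {u v : Vertex R} (p : Path u v) :
    pathLabel k ((actRight x).mapPath p) = pathLabel k p := by
  induction p with
  | nil => rfl
  | cons p e ih => exact congrArg (· * edgeLabel k e) ih

theorem pathLabel_map {L' : Type*} [Group L'] (φ : L →* L') {u v : Vertex R} (p : Path u v) :
    pathLabel (fun r => φ (k r)) p = φ (pathLabel k p) := by
  induction p with
  | nil => exact (map_one φ).symm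
  | cons p e ih =>
    rw [pathLabel, pathLabel, ih, map_mul, edgeLabel, edgeLabel]
    split <;> simp

theorem apply_eq_of_edge {β : Type*} {f : Vertex R → β}
    (hf : ∀ (r : R) (x y : Vertex R), f (x * side r true * y) = f (x * side r false * y))
    {u v : Vertex R} (e : u ⟶ v) : f u = f v := by
  obtain ⟨w₁, r, ε, w₂, rfl, rfl⟩ := e
  cases ε
  · exact (hf r _ _).symm
  · exact hf r _ _

theorem apply_eq_of_path {β : Type*} {f : Vertex R → β}
    (hf : ∀ (r : R) (x y : Vertex R), f (x * side r true * y) = f (x * side r false * y))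
    {u v : Vertex R} (p : Path u v) : f u = f v := by
  induction p with
  | nil => rfl
  | cons p e ih => exact ih.trans (apply_eq_of_edge hf e)

/-- Equality of labels of paths between words of level one is a homotopy relation. -/
theorem isHomotopyRelation_label {lv : Vertex R → ℕ}
    (hmul : ∀ u v, lv (u * v) = min 2 (lv u + lv v))
    (hrule : ∀ r : R, lv (side r true) = lv (side r false))
    (hk : ∀ r : R, lv (side r true) = 0 → k r = 1) :
    IsHomotopyRelation fun u _ p q => lv u = 1 → pathLabel k p = pathLabel k q := by
  have hinv : ∀ (r : R) (x y : Vertex R), lv (x * side r true * y) = lv (x * side r false * y) :=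
    fun r x y => by simp only [hmul, hrule]
  have hedge : ∀ {u v : Vertex R} (e : u ⟶ v), lv u = 0 → edgeLabel k e = 1 := fun e h => by
    have hr : k (DerivationEdge.rule e) = 1 := by
      refine hk _ ?_
      rw [← DerivationEdge.source_eq e, hmul, hmul] at h
      have := hrule (DerivationEdge.rule e)
      rcases hs : DerivationEdge.sign e with _ | _ <;> rw [hs] at h <;> omega
    rw [edgeLabel, hr]
    split <;> simp
  have hpath : ∀ {u v : Vertex R} (p : Path u v), lv u = 0 → pathLabel k p = 1 := fun p h => by
    induction p with
    | nil => rfl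
    | cons p e ih => rw [pathLabel, ih, one_mul, hedge e ((apply_eq_of_path hinv p).symm.trans h)]
  refine ⟨fun u v => ⟨fun _ _ => rfl, fun h hu => (h hu).symm,
    fun h h' hu => (h hu).trans (h' hu)⟩, ?_, ?_, ?_, ?_⟩
  · intro u v u' v' e f hu
    have h₁ : pathLabel k ((actRight u').map e).toPath = edgeLabel k e := pathLabel_toPath k _
    have h₂ : pathLabel k ((actLeft v).map f).toPath = edgeLabel k f := pathLabel_toPath k _
    have h₃ : pathLabel k ((actLeft u).map f).toPath = edgeLabel k f := pathLabel_toPath k _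
    have h₄ : pathLabel k ((actRight v').map e).toPath = edgeLabel k e := pathLabel_toPath k _
    refine ((pathLabel_comp k _ _).trans (congrArg₂ (· * ·) h₁ h₂)).trans
      (Eq.trans ?_ ((pathLabel_comp k _ _).trans (congrArg₂ (· * ·) h₃ h₄)).symm)
    -- The two levels add up to one, so `e` or `f` lives at level zero and has label `1`. The labels
    -- therefore commute even in a nonabelian `L`.
    rw [hmul] at hu
    rcases Nat.eq_zero_or_pos (lv u) with h | h
    · rw [hedge e h, one_mul, mul_one]
    · rw [hedge f (by omega), one_mul, mul_one]
  · intro u v x y p q h hu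
    refine ((pathLabel_actRight k y _).trans (pathLabel_actLeft k x _)).trans
      (Eq.trans ?_ ((pathLabel_actRight k y _).trans (pathLabel_actLeft k x _)).symm)
    rw [hmul, hmul] at hu
    rcases Nat.eq_zero_or_pos (lv u) with h' | h'
    · rw [hpath p h', hpath q h']
    · exact h (by omega)
  · intro t u v w r p q s h ht
    rw [pathLabel_comp, pathLabel_comp, pathLabel_comp, pathLabel_comp,
      h ((apply_eq_of_path hinv r).symm.trans ht)]
  · intro u v p _
    rw [pathLabel_comp, pathLabel_reverse, mul_inv_cancel]
    rfl

/-- Words with the same value are connected in the derivation graph. -/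
theorem nonempty_path_of_mk_eq {u v : Vertex R}
    (h : (PresentedMonoid.mk (fun u v => (u, v) ∈ R) u : MonoidOf R) = PresentedMonoid.mk _ v) :
    Nonempty (Path u v) := by
  let c : Con (FreeMonoid A) :=
    { r := fun u v => Nonempty (Path (V := Vertex R) u v)
      iseqv := ⟨fun _ => ⟨.nil⟩, fun ⟨p⟩ => ⟨p.reverse⟩, fun ⟨p⟩ ⟨q⟩ => ⟨p.comp q⟩⟩
      mul' := fun {w x y z} ⟨p⟩ ⟨q⟩ =>
        ⟨((actRight (R := R) y).mapPath p).comp ((actLeft (R := R) x).mapPath q)⟩ }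
  have hc : conGen (fun u v => (u, v) ∈ R) ≤ c := Con.conGen_le.2 fun x y hxy => by
    have := posEdge (1 : Vertex R) ⟨(x, y), hxy⟩ 1
    rw [one_mul, mul_one, one_mul, mul_one] at this
    exact ⟨this.toPath⟩
  exact hc (PresentedMonoid.mk_eq_mk_iff.1 h)

end Label

/-! ### The matrix group of labels and the arithmetic of its corner entry. -/

section Heisenberg

/-- The group of rational matrices with rows `(1, p, v), (0, t, q), (0, 0, 1)`. -/
@[ext]
structure UpperMatrix : Type where
  t : ℚˣ
  p : ℚ
  q : ℚ
  v : ℚ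

namespace UpperMatrix

instance : Mul UpperMatrix :=
  ⟨fun x y => ⟨x.t * y.t, y.p + x.p * y.t, x.q + x.t * y.q, x.v + y.v + x.p * y.q⟩⟩
instance : One UpperMatrix := ⟨⟨1, 0, 0, 0⟩⟩
instance : Inv UpperMatrix :=
  ⟨fun x => ⟨x.t⁻¹, -(x.p * (x.t⁻¹ : ℚˣ)), -((x.t⁻¹ : ℚˣ) * x.q),
    -x.v + x.p * (x.t⁻¹ : ℚˣ) * x.q⟩⟩

@[simp] theorem mul_t (x y : UpperMatrix) : (x * y).t = x.t * y.t := rfl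
@[simp] theorem mul_p (x y : UpperMatrix) : (x * y).p = y.p + x.p * y.t := rfl
@[simp] theorem mul_q (x y : UpperMatrix) : (x * y).q = x.q + x.t * y.q := rfl
@[simp] theorem mul_v (x y : UpperMatrix) : (x * y).v = x.v + y.v + x.p * y.q := rfl
@[simp] theorem one_t : (1 : UpperMatrix).t = 1 := rfl
@[simp] theorem one_p : (1 : UpperMatrix).p = 0 := rfl
@[simp] theorem one_q : (1 : UpperMatrix).q = 0 := rfl
@[simp] theorem one_v : (1 : UpperMatrix).v = 0 := rfl
@[simp] theorem inv_t (x : UpperMatrix) : x⁻¹.t = x.t⁻¹ := rfl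
@[simp] theorem inv_p (x : UpperMatrix) : x⁻¹.p = -(x.p * (x.t⁻¹ : ℚˣ)) := rfl
@[simp] theorem inv_q (x : UpperMatrix) : x⁻¹.q = -((x.t⁻¹ : ℚˣ) * x.q) := rfl
@[simp] theorem inv_v (x : UpperMatrix) : x⁻¹.v = -x.v + x.p * (x.t⁻¹ : ℚˣ) * x.q := rfl

instance : Group UpperMatrix := Group.ofLeftAxioms
  (fun x y z => by ext <;> simp <;> ring)
  (fun x => by ext <;> simp)
  (fun x => by ext <;> simp)

/-- The block `(t, p)`. -/
def left : UpperMatrix →* UpperMatrix where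
  toFun x := ⟨x.t, x.p, 0, 0⟩
  map_one' := rfl
  map_mul' x y := by ext <;> simp

/-- The block `(t, q)`. -/
def right : UpperMatrix →* UpperMatrix where
  toFun x := ⟨x.t, 0, x.q, 0⟩
  map_one' := rfl
  map_mul' x y := by ext <;> simp

/-- The diagonal entry `t`. -/
def diag : UpperMatrix →* ℚˣ where
  toFun x := x.t
  map_one' := rfl
  map_mul' _ _ := rfl

/-- The central matrices with `v ∈ W`. -/
def central (W : AddSubgroup ℚ) : Subgroup UpperMatrix where
  carrier := {x | x.t = 1 ∧ x.p = 0 ∧ x.q = 0 ∧ x.v ∈ W}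
  one_mem' := ⟨rfl, rfl, rfl, W.zero_mem⟩
  mul_mem' := by
    rintro x y ⟨h₁, h₂, h₃, h₄⟩ ⟨h₁', h₂', h₃', h₄'⟩
    refine ⟨by simp [h₁, h₁'], by simp [h₂, h₂'], by simp [h₃, h₃'], ?_⟩
    simpa [h₂] using W.add_mem h₄ h₄'
  inv_mem' := by
    rintro x ⟨h₁, h₂, h₃, h₄⟩
    refine ⟨by simp [h₁], by simp [h₂], by simp [h₃], ?_⟩
    simpa [h₂] using h₄

theorem mem_central {W : AddSubgroup ℚ} {x : UpperMatrix} :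
    x ∈ central W ↔ x.t = 1 ∧ x.p = 0 ∧ x.q = 0 ∧ x.v ∈ W := Iff.rfl

instance (W : AddSubgroup ℚ) : (central W).Normal where
  conj_mem x hx g := by
    have : g * x * g⁻¹ = x := by
      obtain ⟨h₁, h₂, h₃, -⟩ := hx
      ext <;> simp [h₁, h₂, h₃]
      ring
    rwa [this]

/-- `a ↦ (p = 1)`, `b ↦ (t = 2)`. -/
def ofLeft : FreeGroup Bool →* UpperMatrix :=
  FreeGroup.lift fun x => if x then ⟨Units.mk0 2 two_ne_zero, 0, 0, 0⟩ else ⟨1, 1, 0, 0⟩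

/-- `a ↦ (q = 1)`, `b ↦ (t = 2)`. -/
def ofRight : FreeGroup Bool →* UpperMatrix :=
  FreeGroup.lift fun x => if x then ⟨Units.mk0 2 two_ne_zero, 0, 0, 0⟩ else ⟨1, 0, 1, 0⟩

theorem left_ofLeft (g : FreeGroup Bool) : left (ofLeft g) = ofLeft g := by
  have : left.comp ofLeft = ofLeft := FreeGroup.ext_hom _ _ fun x => by
    cases x <;> simp [ofLeft, left]
  exact DFunLike.congr_fun this g

theorem right_ofRight (g : FreeGroup Bool) : right (ofRight g) = ofRight g := by
  have : right.comp ofRight = ofRight := FreeGroup.ext_hom _ _ fun x => by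
    cases x <;> simp [ofRight, right]
  exact DFunLike.congr_fun this g

/-- The diagonal entry as a function of the exponent of `b`. -/
def diagOfZ2 : Z2 →* ℚˣ :=
  (zpowersHom ℚˣ (Units.mk0 2 two_ne_zero)).comp (MonoidHom.snd _ _)

/-- Both representations have a diagonal entry depending only on the abelianisation, and the same
one. This lets a left block and a right block be assembled into one matrix. -/
theorem ofLeft_t (g : FreeGroup Bool) : (ofLeft g).t = diagOfZ2 (ab g) := by
  have : diag.comp ofLeft = diagOfZ2.comp ab := FreeGroup.ext_hom _ _ fun x => by
    cases x <;> simp [ofLeft, diag, diagOfZ2, ab, genZ2]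
  exact DFunLike.congr_fun this g

theorem ofRight_t (g : FreeGroup Bool) : (ofRight g).t = diagOfZ2 (ab g) := by
  have : diag.comp ofRight = diagOfZ2.comp ab := FreeGroup.ext_hom _ _ fun x => by
    cases x <;> simp [ofRight, diag, diagOfZ2, ab, genZ2]
  exact DFunLike.congr_fun this g

open scoped commutatorElement in
/-- The conjugate of `[a, b]` by `b ^ i`. -/
def conjCommutator (i : ℕ) : FreeGroup Bool :=
  FreeGroup.of true ^ i * ⁅FreeGroup.of false, FreeGroup.of true⁆ * (FreeGroup.of true ^ i)⁻¹

theorem ab_conjCommutator (i : ℕ) : ab (conjCommutator i) = 1 := by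
  simp [conjCommutator, map_commutatorElement, commutatorElement_eq_one_iff_mul_comm, mul_comm]

/-- The commutator itself has `p = 1/2`, and each conjugation by `b` halves it. -/
theorem ofLeft_conjCommutator (i : ℕ) : (ofLeft (conjCommutator i)).p = (2 ^ (i + 1))⁻¹ := by
  have hpow : ofLeft (FreeGroup.of true) ^ i =
      ⟨Units.mk0 2 two_ne_zero ^ i, 0, 0, 0⟩ := by
    induction i with
    | zero => rw [pow_zero, pow_zero]; rfl
    | succ i ih => rw [pow_succ, pow_succ, ih]; ext <;> simp [ofLeft]
  simp only [conjCommutator, commutatorElement_def, map_mul, map_pow, map_inv, hpow]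
  simp [ofLeft, pow_succ]
  ring

theorem ofRight_conjCommutator_zero : (ofRight (conjCommutator 0)).q = -1 := by
  simp [conjCommutator, commutatorElement_def, ofRight]
  norm_num

/-- The Heisenberg commutator: `x * y` and `y * x` differ only in the corner, by `x.p * y.q`. -/
theorem mul_mem_of_commute {W : AddSubgroup ℚ} {x y : UpperMatrix}
    (hxt : x.t = 1) (hyt : y.t = 1) (hxq : x.q = 0) (hyp : y.p = 0)
    (h : x * y / (y * x) ∈ central W) : x.p * y.q ∈ W := by
  have := (mem_central.1 h).2.2.2
  have hv : (x * y / (y * x)).v = x.p * y.q := by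
    rw [div_eq_mul_inv]
    simp [hxt, hyt, hxq, hyp]
    ring
  rwa [hv] at this

end UpperMatrix

theorem exists_common_denominator {S : Set ℚ} (hS : S.Finite) :
    ∃ D : ℤ, D ≠ 0 ∧ ∀ w ∈ AddSubgroup.closure S, ∃ z : ℤ, (D : ℚ) * w = z := by
  induction S, hS using Set.Finite.induction_on with
  | empty =>
    refine ⟨1, one_ne_zero, fun w hw => ⟨0, ?_⟩⟩
    rw [AddSubgroup.closure_empty, AddSubgroup.mem_bot] at hw
    simp [hw]
  | @insert s S _ _ ih =>
    obtain ⟨D, hD, h⟩ := ih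
    refine ⟨D * s.den, mul_ne_zero hD (by exact_mod_cast s.den_nz), fun w hw => ?_⟩
    induction hw using AddSubgroup.closure_induction with
    | mem w hw =>
      rcases hw with rfl | hw
      · exact ⟨D * w.num, by push_cast; rw [mul_assoc, Rat.den_mul_eq_num]⟩
      · obtain ⟨z, hz⟩ := h w (AddSubgroup.subset_closure hw)
        exact ⟨z * s.den, by push_cast; rw [← hz]; ring⟩
    | zero => exact ⟨0, by simp⟩
    | add x y _ _ hx hy =>
      obtain ⟨a, ha⟩ := hx
      obtain ⟨b, hb⟩ := hy
      exact ⟨a + b, by rw [mul_add, ha, hb, Int.cast_add]⟩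
    | neg x _ hx =>
      obtain ⟨a, ha⟩ := hx
      exact ⟨-a, by rw [mul_neg, ha, Int.cast_neg]⟩

theorem not_forall_inv_two_pow_mem {S : Set ℚ} (hS : S.Finite)
    (h : ∀ i : ℕ, ((2 : ℚ) ^ (i + 1))⁻¹ ∈ AddSubgroup.closure S) : False := by
  obtain ⟨D, hD, hz⟩ := exists_common_denominator hS
  -- At `i = |D|` the power `2 ^ (|D| + 1)` would divide `D`, although it exceeds `|D|`.
  obtain ⟨z, hz⟩ := hz _ (h D.natAbs)
  refine hD (Int.eq_zero_of_dvd_of_natAbs_lt_natAbs (d := 2 ^ (D.natAbs + 1)) ⟨z, ?_⟩ ?_)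
  · have : (D : ℚ) = 2 ^ (D.natAbs + 1) * z := by
      rw [← hz]; field_simp
    exact_mod_cast this
  · rw [Int.natAbs_pow]
    exact (Nat.lt_succ_self _).trans Nat.lt_two_pow_self

end Heisenberg

end SemigroupFDT

/-! ### Marked normal forms and their labels. -/

namespace SemigroupFDT

open Quiver

/-- The normal forms with a marked position of the letter `h`: `mid x y` stands for `x h y`. -/
inductive PathModel : Type
  | unit (g : FreeGroup Bool)
  | mid (x y : FreeGroup Bool)
  | zero

namespace PathModel

/-- Multiplication of marked normal forms. -/
protected def mul : PathModel → PathModel → PathModel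
  | unit g, unit k => unit (g * k)
  | unit g, mid x y => mid (g * x) y
  | mid x y, unit g => mid x (y * g)
  | _, _ => zero

instance : Monoid PathModel where
  mul := PathModel.mul
  one := unit 1
  mul_assoc := by
    rintro (g | ⟨x, y⟩ | _) (g' | ⟨x', y'⟩ | _) (g'' | ⟨x'', y''⟩ | _) <;>
    first
      | rfl
      | exact congrArg unit (mul_assoc _ _ _)
      | exact congrArg₂ mid (mul_assoc _ _ _) rfl
      | exact congrArg₂ mid rfl (mul_assoc _ _ _)
  one_mul := by
    rintro (g | ⟨x, y⟩ | _)
    · exact congrArg unit (one_mul _)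
    · exact congrArg₂ mid (one_mul _) rfl
    · rfl
  mul_one := by
    rintro (g | ⟨x, y⟩ | _)
    · exact congrArg unit (mul_one _)
    · exact congrArg₂ mid rfl (mul_one _)
    · rfl

/-- The underlying normal form. -/
def toModel : PathModel →* Model where
  toFun
    | unit g => .unit g
    | mid x y => .mid (ab x * ab y)
    | zero => .zero
  map_one' := rfl
  map_mul' := by
    rintro (g | ⟨x, y⟩ | _) (g' | ⟨x', y'⟩ | _) <;>
    first
      | rfl
      | exact congrArg Model.mid (by rw [map_mul, mul_assoc])

theorem toModel_surjective : Function.Surjective toModel := by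
  rintro (g | v | _)
  · exact ⟨unit g, rfl⟩
  · exact ⟨mid (abSection v) 1, congrArg Model.mid (by rw [map_one, mul_one, ab_abSection])⟩
  · exact ⟨zero, rfl⟩

/-- The part on the left of `h`. -/
def fst : PathModel → FreeGroup Bool
  | mid x _ => x
  | _ => 1

/-- The part on the right of `h`. -/
def snd : PathModel → FreeGroup Bool
  | mid _ y => y
  | _ => 1

/-- The number of occurrences of `h`, truncated at `2`. -/
def level : PathModel → ℕ
  | unit _ => 0
  | mid _ _ => 1
  | zero => 2

theorem level_mul (e f : PathModel) : (e * f).level = min 2 (e.level + f.level) := by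
  rcases e with g | ⟨x, y⟩ | _ <;> rcases f with g' | ⟨x', y'⟩ | _ <;> rfl

theorem eq_unit_of_toModel {x : PathModel} {g : FreeGroup Bool} (h : x.toModel = .unit g) :
    x = unit g := by
  rcases x with k | ⟨x, y⟩ | _
  · exact congrArg unit (Model.unit.inj h)
  · exact absurd h (by simp [toModel])
  · exact absurd h (by simp [toModel])

theorem level_eq_of_toModel_eq {e f : PathModel} (h : e.toModel = f.toModel) :
    e.level = f.level := by
  rcases e with g | ⟨x, y⟩ | _ <;> rcases f with g' | ⟨x', y'⟩ | _ <;>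
  first
    | rfl
    | exact absurd h (by simp [toModel])

/-- The label of a rule with the given sides. -/
def label (r s : PathModel) : UpperMatrix :=
  -- The right block has the same `t` whenever `r` and `s` have the same underlying normal form. The
  -- corner is not constrained by the endpoints and is set to `0`.
  ⟨(UpperMatrix.ofLeft (r.fst⁻¹ * s.fst)).t, (UpperMatrix.ofLeft (r.fst⁻¹ * s.fst)).p,
    (UpperMatrix.ofRight (r.snd * s.snd⁻¹)).q, 0⟩

theorem label_of_level_eq_zero {r s : PathModel} (hr : r.level = 0) (hs : s.level = 0) :
    label r s = 1 := by
  rcases r with g | ⟨x, y⟩ | _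
  · rcases s with k | ⟨x, y⟩ | _
    · simp [label, fst, snd]; rfl
    · cases hs
    · cases hs
  · cases hr
  · cases hr

/-- At level one either the rule is trivial, or `x` and `y` are units and cancel from the two
quotients. -/
theorem label_mul {x r s y : PathModel} (h : r.toModel = s.toModel)
    (hl : (x * r * y).level = 1) :
    UpperMatrix.left (label r s) = UpperMatrix.ofLeft ((x * r * y).fst⁻¹ * (x * s * y).fst) ∧
    UpperMatrix.right (label r s) =
      UpperMatrix.ofRight ((x * r * y).snd * (x * s * y).snd⁻¹) := by
  rcases r with g | ⟨u, v⟩ | _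
  · obtain rfl := eq_unit_of_toModel h.symm
    rw [label_of_level_eq_zero rfl rfl]
    simp
  · rcases s with k | ⟨u', v'⟩ | _
    · exact absurd h (by simp [toModel])
    · have hab : ab u * ab v = ab u' * ab v' := Model.mid.inj h
      rw [level_mul, level_mul] at hl
      change min 2 (min 2 (x.level + 1) + y.level) = 1 at hl
      rcases x with g | ⟨_, _⟩ | _
      · rcases y with k | ⟨_, _⟩ | _
        · have h₁ : (g * u)⁻¹ * (g * u') = u⁻¹ * u' := by group
          have h₂ : v * k * (v' * k)⁻¹ = v * v'⁻¹ := by group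
          change UpperMatrix.left (label (mid u v) (mid u' v')) =
              UpperMatrix.ofLeft ((g * u)⁻¹ * (g * u')) ∧
            UpperMatrix.right (label (mid u v) (mid u' v')) =
              UpperMatrix.ofRight (v * k * (v' * k)⁻¹)
          rw [h₁, h₂, ← UpperMatrix.left_ofLeft, ← UpperMatrix.right_ofRight]
          refine ⟨rfl, UpperMatrix.ext ?_ rfl rfl rfl⟩
          -- From `ab u * ab v = ab u' * ab v'`, the two quotients have the same abelianisation.
          change (UpperMatrix.ofLeft (u⁻¹ * u')).t = (UpperMatrix.ofRight (v * v'⁻¹)).t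
          rw [UpperMatrix.ofLeft_t, UpperMatrix.ofRight_t]
          refine congrArg _ ?_
          rw [map_mul, map_mul, map_inv, map_inv, inv_mul_eq_iff_eq_mul, ← mul_assoc, hab,
            mul_inv_cancel_right]
        · simp [level] at hl
        · simp [level] at hl
      · simp [level] at hl
      · simp [level] at hl
    · exact absurd h (by simp [toModel])
  · rw [level_mul, level_mul] at hl
    change min 2 (min 2 (x.level + 2) + y.level) = 1 at hl
    omega

end PathModel

/-! ### The obstruction to finite derivation type. -/

section NotFDT

variable {A : Type*} {R : RewritingSystem A}

-- The quotients of consecutive marked forms telescope along the path, so everything but the corner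
-- depends on the endpoints alone.
open PathModel in
theorem pathLabel_eq (ψ : Vertex R →* PathModel)
    (hψ : ∀ r : R, (ψ (side r true)).toModel = (ψ (side r false)).toModel)
    {u v : Vertex R} (p : Path u v) (hu : (ψ u).level = 1) :
    UpperMatrix.left (pathLabel (fun r => label (ψ (side r true)) (ψ (side r false))) p) =
      UpperMatrix.ofLeft ((ψ u).fst⁻¹ * (ψ v).fst) ∧
    UpperMatrix.right (pathLabel (fun r => label (ψ (side r true)) (ψ (side r false))) p) =
      UpperMatrix.ofRight ((ψ u).snd * (ψ v).snd⁻¹) := by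
  have hinv : ∀ (r : R) (x y : Vertex R),
      (ψ (x * side r true * y)).level = (ψ (x * side r false * y)).level := fun r x y => by
    refine level_eq_of_toModel_eq ?_
    simp only [map_mul, hψ]
  induction p with
  | nil => simp [pathLabel]
  | @cons w v p e ih =>
    have hw := (apply_eq_of_path (f := fun u => (ψ u).level) hinv p).symm.trans hu
    have hv := (apply_eq_of_edge (f := fun u => (ψ u).level) hinv e).symm.trans hw
    rw [pathLabel, map_mul UpperMatrix.left, map_mul UpperMatrix.right, ih.1, ih.2]
    have key : UpperMatrix.left (edgeLabel (fun r => label (ψ (side r true)) (ψ (side r false))) e) =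
          UpperMatrix.ofLeft ((ψ w).fst⁻¹ * (ψ v).fst) ∧
        UpperMatrix.right (edgeLabel (fun r => label (ψ (side r true)) (ψ (side r false))) e) =
          UpperMatrix.ofRight ((ψ w).snd * (ψ v).snd⁻¹) := by
      obtain ⟨w₁, r, ε, w₂, rfl, rfl⟩ := e
      simp only [map_mul ψ] at hw hv ⊢
      cases ε
      · have := label_mul (hψ r) hv
        simp only [edgeLabel, Bool.false_eq_true, if_false, map_inv, this]
        rw [← map_inv, ← map_inv, mul_inv_rev, mul_inv_rev, inv_inv, inv_inv]
        exact ⟨rfl, rfl⟩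
      · exact label_mul (hψ r) hw
    rw [key.1, key.2, ← map_mul, ← map_mul]
    constructor <;> congr 1 <;> group

/-- Absorbs the reassociation between `d * (c * e)` and `d * c * e` at the end of a translated path.
-/
theorem exists_pathLabel_actLeft {L : Type*} [Group L] (k : R → L) (x : Vertex R)
    {u v u' v' : Vertex R} (p : Path u v) (hu : u' = x * u) (hv : v' = x * v) :
    ∃ q : Path u' v', pathLabel k q = pathLabel k p := by
  subst hu hv
  exact ⟨_, pathLabel_actLeft k x p⟩

open PathModel UpperMatrix in
/-- In a presentation of `M` with a finite homotopy base, the products of the corner entries of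
the labels of the loops in `F' × 1` and `1 × F'` lie in a finitely generated group. -/
theorem exists_finite_of_presentationHasFDT (ψ : Vertex R →* PathModel)
    (hψ : ∀ u v : Vertex R, (ψ u).toModel = (ψ v).toModel ↔ Nonempty (Path u v))
    (hsurj : ∀ y, ∃ u : Vertex R, (ψ u).toModel = y) (hR : PresentationHasFDT R) :
    ∃ S : Set ℚ, S.Finite ∧ ∀ m n : FreeGroup Bool, ab m = 1 → ab n = 1 →
      (ofLeft m).p * (ofRight n).q ∈ AddSubgroup.closure S := by
  obtain ⟨C, hC, hbase⟩ := hR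
  have hrule : ∀ r : R, (ψ (side r true)).toModel = (ψ (side r false)).toModel := fun r => by
    refine (hψ _ _).2 ?_
    have := (posEdge (1 : Vertex R) r 1).toPath
    rw [one_mul, mul_one, one_mul, mul_one] at this
    exact ⟨this⟩
  set k : R → UpperMatrix := fun r => label (ψ (side r true)) (ψ (side r false)) with hk
  have hpath : ∀ {u v : Vertex R} (p : Path u v), (ψ u).level = 1 →
      left (pathLabel k p) = ofLeft ((ψ u).fst⁻¹ * (ψ v).fst) ∧
      right (pathLabel k p) = ofRight ((ψ u).snd * (ψ v).snd⁻¹) := pathLabel_eq ψ hrule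
  set S : Set ℚ := (fun c : ParallelPair R =>
    (pathLabel k c.2.2.1 / pathLabel k c.2.2.2).v) '' C with hS
  refine ⟨S, hC.image _, fun m n hm hn => ?_⟩
  set N := central (AddSubgroup.closure S) with hN
  have hlv : ∀ r : R, (ψ (side r true)).level = (ψ (side r false)).level :=
    fun r => level_eq_of_toModel_eq (hrule r)
  have hhom := isHomotopyRelation_label (fun r => QuotientGroup.mk' N (k r))
    (lv := fun u => (ψ u).level) (fun u v => by rw [map_mul, level_mul]) hlv
    (fun r h => by rw [hk]; simp only [label_of_level_eq_zero h ((hlv r).symm.trans h), map_one])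
  have hmem : ∀ {u v : Vertex R} (p q : Path u v), (ψ u).level = 1 →
      pathLabel k p / pathLabel k q ∈ N := fun {u v} p q hu => by
    have := hbase u v p q _ hhom ?_ hu
    · rw [pathLabel_map, pathLabel_map] at this
      exact QuotientGroup.eq_iff_div_mem.1 this
    · rintro ⟨u, v, p, q⟩ hc hu
      rw [pathLabel_map, pathLabel_map]
      refine QuotientGroup.eq_iff_div_mem.2 ?_
      -- A pair of the base has equal left and right blocks, so its discrepancy is central, with
      -- corner in `S` by construction.
      have h₁ : left (pathLabel k p / pathLabel k q) = 1 := by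
        rw [map_div, (hpath p hu).1, (hpath q hu).1, div_self']
      have h₂ : right (pathLabel k p / pathLabel k q) = 1 := by
        rw [map_div, (hpath p hu).2, (hpath q hu).2, div_self']
      exact ⟨congrArg UpperMatrix.t h₁, congrArg UpperMatrix.p h₁, congrArg UpperMatrix.q h₂,
        AddSubgroup.subset_closure ⟨_, hc, rfl⟩⟩
  obtain ⟨c, hc⟩ := hsurj (.mid 1)
  obtain ⟨x, y, hxy⟩ : ∃ x y, ψ c = mid x y := by
    rcases h : ψ c with g | ⟨x, y⟩ | _
    · rw [h] at hc; exact absurd hc (by simp [PathModel.toModel])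
    · exact ⟨x, y, rfl⟩
    · rw [h] at hc; exact absurd hc (by simp [PathModel.toModel])
  -- The lift of `c` is `x h y` with `x`, `y` possibly nontrivial. Conjugating by them makes the
  -- quotients exactly `m` and `n`; the inverse of `n` appears because the right quotient is `y
  -- y'⁻¹`.
  obtain ⟨d, hd⟩ := hsurj (.unit (x * m * x⁻¹))
  obtain ⟨e, he⟩ := hsurj (.unit (y⁻¹ * n⁻¹ * y))
  have hd' := eq_unit_of_toModel hd
  have he' := eq_unit_of_toModel he
  have habd : ab (x * m * x⁻¹) = 1 := by simp [hm]
  have habe : ab (y⁻¹ * n⁻¹ * y) = 1 := by simp [hn]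
  obtain ⟨α⟩ := (hψ c (d * c)).1 (by
    rw [map_mul, map_mul, hd, hc, Model.unit_mul_mid, habd, one_mul])
  obtain ⟨β⟩ := (hψ c (c * e)).1 (by
    rw [map_mul, map_mul, he, hc, Model.mid_mul_unit, habe, one_mul])
  have hlc : (ψ c).level = 1 := by rw [hxy]; rfl
  have hα := hpath α hlc
  have hβ := hpath β hlc
  rw [map_mul ψ d c, hxy, hd'] at hα
  rw [map_mul ψ c e, hxy, he'] at hβ
  have e₁ : x⁻¹ * (x * m * x⁻¹ * x) = m := by group
  have e₂ : y * (y * (y⁻¹ * n⁻¹ * y))⁻¹ = n := by group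
  change left _ = ofLeft (x⁻¹ * (x * m * x⁻¹ * x)) ∧ right _ = ofRight (y * y⁻¹) at hα
  change left _ = ofLeft (x⁻¹ * x) ∧ right _ = ofRight (y * (y * (y⁻¹ * n⁻¹ * y))⁻¹) at hβ
  rw [e₁, mul_inv_cancel, map_one] at hα
  rw [e₂, inv_mul_cancel, map_one] at hβ
  obtain ⟨β', hβ'⟩ := exists_pathLabel_actLeft k d β (u' := d * c) (v' := d * c * e) rfl
    (mul_assoc _ _ _)
  -- Two routes from `c` to `d * c * e`, both rewriting the factor with the letter `h`, so that
  -- interchange does not identify them.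
  have hcomm := hmem (α.comp β') (β.comp ((actRight e).mapPath α)) hlc
  have hα' : pathLabel k ((actRight e).mapPath α) = pathLabel k α := pathLabel_actRight k e α
  have hcomm' : pathLabel k α * pathLabel k β / (pathLabel k β * pathLabel k α) ∈ N := by
    rw [pathLabel_comp, hβ'] at hcomm
    have h₂ : pathLabel k (β.comp ((actRight e).mapPath α)) = pathLabel k β * pathLabel k α :=
      (pathLabel_comp k _ _).trans (congrArg _ hα')
    rwa [← h₂]
  have hp : (ofLeft m).p = (pathLabel k α).p := (congrArg UpperMatrix.p hα.1).symm
  have hq : (ofRight n).q = (pathLabel k β).q := (congrArg UpperMatrix.q hβ.2).symm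
  rw [hp, hq]
  exact mul_mem_of_commute (congrArg UpperMatrix.t hα.2) (congrArg UpperMatrix.t hβ.1)
    (congrArg UpperMatrix.q hα.2) (congrArg UpperMatrix.p hβ.1) hcomm'

theorem not_presentationHasFDT_of_mulEquiv (f : M ≃* MonoidOf R) : ¬ PresentationHasFDT R := by
  intro hR
  let val : FreeMonoid A →* Model :=
    (modelEquiv.toMonoidHom.comp f.symm.toMonoidHom).comp (PresentedMonoid.mk _)
  -- Any choice of lifts of the generators works: only multiplicativity and compatibility with the
  -- value in `Model` are needed.
  let ψ : FreeMonoid A →* PathModel := FreeMonoid.lift fun a =>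
    Function.surjInv PathModel.toModel_surjective (val (FreeMonoid.of a))
  have hψval : ∀ w, (ψ w).toModel = val w := by
    have : PathModel.toModel.comp ψ = val := FreeMonoid.hom_eq fun a => by
      rw [MonoidHom.comp_apply, FreeMonoid.lift_eval_of]
      exact Function.surjInv_eq _ _
    exact DFunLike.congr_fun this
  have hval : ∀ u v, val u = val v ↔
      (PresentedMonoid.mk (fun u v => (u, v) ∈ R) u : MonoidOf R) = PresentedMonoid.mk _ v :=
    fun u v => modelEquiv.injective.eq_iff.trans f.symm.injective.eq_iff
  obtain ⟨S, hS, h⟩ := exists_finite_of_presentationHasFDT (R := R) ψ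
    (fun u v => ((iff_of_eq (congrArg₂ (· = ·) (hψval u) (hψval v))).trans (hval u v)).trans
      ⟨nonempty_path_of_mk_eq, fun ⟨p⟩ => apply_eq_of_path
        (f := fun w : Vertex R => (PresentedMonoid.mk (fun u v => (u, v) ∈ R) w : MonoidOf R))
        (fun r x y => Step.mk_eq ⟨r.1, r.2, x, y, rfl, rfl⟩) p⟩)
    (fun y => by
      obtain ⟨w, hw⟩ := PresentedMonoid.surjective_mk (f (modelEquiv.symm y))
      refine ⟨w, (hψval w).trans ?_⟩
      change modelEquiv (f.symm (PresentedMonoid.mk _ w)) = y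
      rw [hw, MulEquiv.symm_apply_apply, MulEquiv.apply_symm_apply]) hR
  refine not_forall_inv_two_pow_mem hS fun i => ?_
  have := h _ _ (UpperMatrix.ab_conjCommutator i) (UpperMatrix.ab_conjCommutator 0)
  rw [UpperMatrix.ofLeft_conjCommutator, UpperMatrix.ofRight_conjCommutator_zero, mul_neg_one] at this
  exact neg_mem_iff.1 this

theorem not_hasFDT_M : ¬ HasFDT M := fun ⟨_, _, _, _, ⟨f⟩, hR⟩ =>
  not_presentationHasFDT_of_mulEquiv f hR

end NotFDT

end SemigroupFDT

theorem mainTheorem4 :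
    SemigroupFDT.greenIndex SemigroupFDT.unitsM < ⊤ ∧
    (SemigroupFDT.HasFiniteCompleteRewritingSystem SemigroupFDT.unitsM ∧
      SemigroupFDT.HasFDT SemigroupFDT.unitsM) ∧
    (∀ H ∈ SemigroupFDT.outerHClasses SemigroupFDT.unitsM,
      SemigroupFDT.HasFiniteCompleteRewritingSystem
        (SemigroupFDT.SchutzenbergerGroup SemigroupFDT.unitsM H) ∧
      SemigroupFDT.HasFDT (SemigroupFDT.SchutzenbergerGroup SemigroupFDT.unitsM H)) ∧
    ¬ SemigroupFDT.HasFDT SemigroupFDT.M ∧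
    ¬ SemigroupFDT.HasFiniteCompleteRewritingSystem SemigroupFDT.M :=
  have hT := SemigroupFDT.hasFiniteCompleteRewritingSystem_unitsM
  ⟨SemigroupFDT.greenIndex_lt_top, ⟨hT, hT.hasFDT⟩,
    fun _ hH =>
      have h := SemigroupFDT.hasFiniteCompleteRewritingSystem_schutzenbergerGroup hH
      ⟨h, h.hasFDT⟩,
    SemigroupFDT.not_hasFDT_M, fun h => SemigroupFDT.not_hasFDT_M h.hasFDT⟩
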